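/- **Setting.** Let $R,L,\mu>0$, and let $\mathcal K,\mathcal K^*\subseteq B(0,R)\subset\mathbb R^d$ be compact, with $\mathcal K^*$ nonempty. Let $W\subseteq\mathbb R^d$ be a convex cone (containing $0$) with nonempty interior and dual cone $W^\circ=\{c: w^\top c\ge 0\ \forall w\in W\}$. An improper linear optimization oracle is a map $\mathcal O$ such that for every $v\in W$, $\mathcal O(v)\in\mathcal K$ and $v^\top\mathcal O(v)\le \min_{x^*\in\mathcal K^*}v^\top x^*$. Let $\varphi:\mathcal A\to\mathbb R$ be Legendre: $\mathcal A\subseteq\mathbb R^d$ is convex, $\varphi$ is strictly convex with continuous gradient on $\mathrm{int}\,\mathcal A$, and $\|\nabla\varphi(x_n)\|\to\infty$ whenever $x_n\in \mathrm{int}\,\mathcal A$ converges to a boundary point of $\mathcal A$. Assume that $\mathcal K^*\subseteq\mathcal A$, that $\varphi$ is twice differentiable on $\mathrm{int}\,\mathcal A$, that $\varphi$ is $\mu$-strongly convex on $\mathcal A$, and that $(\varphi,W)$ has the pairwise non-negative inner product (PNIP) property: $w^\top H^{-1}w'\ge0$ for all $w,w'\in W$ and all $H$ in the convex hull of $\{\nabla^2\varphi(x):x\in\mathrm{int}\,\mathcal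 A\}$. Let $D_\varphi(x,y)=\varphi(x)-\varphi(y)-\nabla\varphi(y)^\top(x-y)$. **Algorithm** (online mirror descent), with parameters $\eta>0$, $\epsilon\in(0,R]$, $T\ge1$. Start at $y_1=\arg\min_{\mathcal A}\varphi$. In round $t=1,\dots,T$: 1. Set $z_1=y_t$, $W_1=W\cap B(0,1)$, $i=0$. While $i<5d\log\frac{2(R+\|z_{i+1}\|)}{\epsilon}$: increase $i$ by $1$; let $w_i=\int_{W_i}w\,dw/\mathrm{vol}(W_i)$ (any point of $W_i$ if $\mathrm{vol}(W_i)=0$); call the oracle to get $v_i=\mathcal O(w_i)$; let $z_{i+1}$ minimize $D_\varphi(z,z_i)$ over $z\in\mathcal A$ with $w_i^\top(z-v_i)\ge0$; let $W_{i+1}=W_i\cap\{w:w^\top(v_i-z_{i+1})\ge0\}$. 2. When the loop has stopped after $k$ iterations, set $x_t=z_{k+1}$ and let $p\in\Delta^{k-1}$, $c\in W^\circ$ minimize $\|\sum_{i\le k}p_iv_i+c-x_t\|$. Play $v_i$ with probability $p_i$ and observe a loss vector $f_t\in W$ with $\|f_t\|\le L$, chosen by an arbitrary adversary. 3. Choose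 $y_{t+1}$ with $\nabla\varphi(y_{t+1})=\nabla\varphi(x_t)-\eta f_t$. Here the points $z_{i+1}$ and $y_{t+1}$ are required to lie in $\mathrm{int}\,\mathcal A$, where $\nabla\varphi$ exists. **Theorem.** Let $A\ge\max_{x^*\in\mathcal K^*}(\varphi(x^*)-\varphi(y_1))$. Then in every execution the algorithm calls the oracle in each round at most $$\left\lceil 5d\log\frac{4R+2\sqrt{\frac2\mu\left(A+\left(\frac{\eta^2L^2}{2\mu}+2\eta LR+\epsilon\eta L\right)T\right)}}{\epsilon}\right\rceil$$ times. In particular, for $\epsilon=\frac RT$ and $\eta=\frac1L\sqrt{\frac{2\mu A}{T}}$, it calls the oracle in each round at most $$\left\lceil5d\log\left(\left(6\sqrt T+\frac4R\sqrt{\frac A\mu}+4\right)T\right)\right\rceil$$ times. For fixed $R,A,\mu$, the last bound is $O(d\log T)$, uniformly in $d$ and $T\ge2$. -/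

import Mathlib

open scoped Gradient RealInnerProductSpace

noncomputable section

namespace OnlineImproper

/-- `ℝ^d` with the Euclidean norm. -/
abbrev Vec (d : ℕ) : Type := EuclideanSpace ℝ (Fin d)

/-- `f` is a Legendre function with domain `D` (only the values of `f` on `D` matter). -/
structure IsLegendre {d : ℕ} (D : Set (Vec d)) (f : Vec d → ℝ) : Prop where
  convex : Convex ℝ D
  strictConvex : StrictConvexOn ℝ (interior D) f
  differentiable : ∀ x ∈ interior D, DifferentiableAt ℝ f x
  continuous_gradient : ContinuousOn (∇ f) (interior D)
  gradient_blowup : ∀ u : ℕ → Vec d, (∀ n, u n ∈ interior D) → ∀ x ∈ frontier D,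
    Filter.Tendsto u Filter.atTop (nhds x) →
    Filter.Tendsto (fun n => ‖∇ f (u n)‖) Filter.atTop Filter.atTop

/-- The Hessian of `f` at `x`, as the linear map given by the derivative of the gradient. -/
def hessian {d : ℕ} (f : Vec d → ℝ) (x : Vec d) : Vec d →L[ℝ] Vec d :=
  fderiv ℝ (∇ f) x

/-- The pairwise non-negative inner product property of a twice differentiable Legendre function
`φ` with domain `D` and a convex cone `W` (a `PointedCone` is a nonempty convex cone). -/
structure PNIP {d : ℕ} (D : Set (Vec d)) (φ : Vec d → ℝ) (W : PointedCone ℝ (Vec d)) : Prop where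
  legendre : IsLegendre D φ
  twiceDifferentiable : ∀ x ∈ interior D, DifferentiableAt ℝ (∇ φ) x
  inner_nonneg : ∀ H ∈ convexHull ℝ (hessian φ '' interior D),
    H.IsInvertible ∧ ∀ w ∈ W, ∀ w' ∈ W, 0 ≤ ⟪w, H.inverse w'⟫

/-- The Bregman divergence `D_φ(x, y)`. -/
def bregman {d : ℕ} (φ : Vec d → ℝ) (x y : Vec d) : ℝ :=
  φ x - φ y - ⟪∇ φ y, x - y⟫

/-- `O` is an improper linear optimization oracle: on every input `v ∈ W` it answers with a point
of `K` that is at least as good in direction `v` as every point of `Kstar`. -/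
def IsImproperOracle {d : ℕ} (K Kstar : Set (Vec d)) (W : PointedCone ℝ (Vec d))
    (O : Vec d → Vec d) : Prop :=
  ∀ v ∈ W, O v ∈ K ∧ ∀ x ∈ Kstar, ⟪v, O v⟫ ≤ ⟪v, x⟫

/-- `w` is the centroid `(∫_S w dw) / vol S` of `S`. If `S` has volume zero, the quotient is not
defined, and any point of `S` is allowed. -/
def IsCentroid {d : ℕ} (S : Set (Vec d)) (w : Vec d) : Prop :=
  (MeasureTheory.volume S ≠ 0 →
    w = (MeasureTheory.volume S).toReal⁻¹ • ∫ x in S, x) ∧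
  (MeasureTheory.volume S = 0 → w ∈ S)

/-- `z'` is the Bregman projection of `z` onto `H`, i.e. a minimizer of `D_φ(·, z)` over the points
of `H` in the domain `D` of `φ`. It has to lie in the interior of `D`, where `∇ φ` exists. -/
def IsBregmanProj {d : ℕ} (D : Set (Vec d)) (φ : Vec d → ℝ) (H : Set (Vec d))
    (z z' : Vec d) : Prop :=
  z' ∈ interior D ∧ z' ∈ H ∧ IsMinOn (fun u => bregman φ u z) (D ∩ H) z'

/-- The condition of the while loop of the projection-and-decomposition algorithm after `i`
iterations, when the current point is `z`. -/
def LoopGuard (d : ℕ) (R ε : ℝ) (i : ℕ) (z : Vec d) : Prop :=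
  (i : ℝ) < 5 * d * Real.log (2 * (R + ‖z‖) / ε)

/-- The states that the loop of the projection-and-decomposition algorithm started at `y` can
reach. In `PADLoop R ε D φ W O y z S V`, the list `V = [v₁, …, v_i]` holds the answers to all oracle
calls made so far, in order (one call per iteration, so `V.length` is both the number `i` of
iterations and the number of oracle calls), `z` is `z_{i+1}` and `S` is `W_{i+1}`. -/
inductive PADLoop {d : ℕ} (R ε : ℝ) (D : Set (Vec d)) (φ : Vec d → ℝ)
    (W : PointedCone ℝ (Vec d)) (O : Vec d → Vec d) (y : Vec d) :
    Vec d → Set (Vec d) → List (Vec d) → Prop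
  | start : PADLoop R ε D φ W O y y ((W : Set (Vec d)) ∩ Metric.closedBall 0 1) []
  | step {z z' w : Vec d} {S : Set (Vec d)} {V : List (Vec d)}
      (prev : PADLoop R ε D φ W O y z S V)
      (guard : LoopGuard d R ε V.length z)
      (centroid : IsCentroid S w)
      (proj : IsBregmanProj D φ {u | 0 ≤ ⟪w, u - O w⟫} z z') :
      PADLoop R ε D φ W O y z' (S ∩ {u | 0 ≤ ⟪u, O w - z'⟫}) (V ++ [O w])

/-- The projection-and-decomposition algorithm on input `y` can return `(x, V, p)`: the loop has
stopped, and `p` solves `min ‖∑ pᵢ vᵢ + c - x‖` over `p` in the simplex and `c` in the dual cone. -/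
def PADReturns {d : ℕ} (R ε : ℝ) (D : Set (Vec d)) (φ : Vec d → ℝ)
    (W : PointedCone ℝ (Vec d)) (O : Vec d → Vec d) (y x : Vec d)
    (V : List (Vec d)) (p : Fin V.length → ℝ) : Prop :=
  (∃ S, PADLoop R ε D φ W O y x S V) ∧ ¬ LoopGuard d R ε V.length x ∧
  p ∈ stdSimplex ℝ (Fin V.length) ∧
  ∃ c ∈ ProperCone.innerDual (W : Set (Vec d)),
    ∀ q ∈ stdSimplex ℝ (Fin V.length), ∀ c' ∈ ProperCone.innerDual (W : Set (Vec d)),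
      ‖∑ i, p i • V.get i + c - x‖ ≤ ‖∑ i, q i • V.get i + c' - x‖

/-- `OMDReach R ε η L D φ W O t y`: some execution of online mirror descent against some adversary
begins round `t` (counted from `1`) at the point `y_t = y`. The loss vector `f` of each round is an
arbitrary element of `W ∩ B(0, L)`, so it may depend on the whole history and on the random points
that were played; those points influence the algorithm only through the losses. -/
inductive OMDReach {d : ℕ} (R ε η L : ℝ) (D : Set (Vec d)) (φ : Vec d → ℝ)
    (W : PointedCone ℝ (Vec d)) (O : Vec d → Vec d) : ℕ → Vec d → Prop
  | start {y : Vec d} (mem : y ∈ D) (isMin : IsMinOn φ D y) : OMDReach R ε η L D φ W O 1 y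
  | round {t : ℕ} {y x y' f : Vec d} {V : List (Vec d)} {p : Fin V.length → ℝ}
      (prev : OMDReach R ε η L D φ W O t y)
      (pad : PADReturns R ε D φ W O y x V p)
      (loss_mem : f ∈ W) (loss_le : ‖f‖ ≤ L)
      (mem : y' ∈ interior D)
      (update : ∇ φ y' = ∇ φ x - η • f) :
      OMDReach R ε η L D φ W O (t + 1) y'

/-- `N` bounds the number of oracle calls in each of the rounds `1, …, T`, in every execution. All
states of the loop are considered, so the loop also terminates after at most `N` iterations. -/
def CallsPerRoundLE {d : ℕ} (R ε η L : ℝ) (D : Set (Vec d)) (φ : Vec d → ℝ)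
    (W : PointedCone ℝ (Vec d)) (O : Vec d → Vec d) (T N : ℕ) : Prop :=
  ∀ t ≤ T, ∀ y, OMDReach R ε η L D φ W O t y →
    ∀ z S V, PADLoop R ε D φ W O y z S V → V.length ≤ N

end OnlineImproper

end

namespace OnlineImproper

open MeasureTheory Set
open scoped Pointwise

/-! ### The Brunn–Minkowski inequality in multiplicative form -/

/-! The loop guard compares the number of iterations with the logarithm of `R + ‖z‖`, so it suffices
to bound every intermediate point `z`. Fix `x*` in `Kstar`. It lies in each half-space that is
projected onto, so projections do not increase `D_φ(x*, ·)`. A gradient step from `x` increases it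
by at most `η²L²/(2μ) + η⟪f, x* - x⟫`. At `y₁` it is at most `A`, because the gradient vanishes
there, and strong convexity turns a bound on `D_φ(x*, z)` into one on `‖z‖`.

The term `⟪f, x* - x⟫` needs the returned `x` to be within `ε` of `s + c`, where `s` is a convex
combination of oracle answers and `c` is in the dual cone (`PADReturns.norm_le`): then `⟪f, x* - s⟫
≤ 2LR`, the error costs `εL`, and `⟪f, c⟫ ≥ 0`. If the approximation failed, some `u ∈ W` in the
unit ball would satisfy `⟪u, v - x⟫ > ε` for all answers `v`. By PNIP the points `z` move only in
directions of the dual cone (`PNIP.inner_sub_nonneg`), so `u` and a small copy of `W ∩ B(0,1)` near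
it survive every cut. But each cut goes through or beyond the centroid and leaves at most a fraction
`1 - 1/e` of the volume (`grunbaum`), so after `5d log(1/δ)` cuts too little volume is left.
Grünbaum's inequality rests on the log-concavity of section volumes, hence on Brunn–Minkowski,
obtained from Prékopa–Leindler on the line. -/

theorem volume_add_le_of_isCompact {K L C : Set ℝ} (hK : IsCompact K) (hL : IsCompact L)
    (hK₀ : K.Nonempty) (hL₀ : L.Nonempty) {a b : ℝ} (ha : 0 < a) (hb : 0 < b)
    (h : ∀ x ∈ K, ∀ y ∈ L, a * x + b * y ∈ C) :
    ENNReal.ofReal a * volume K + ENNReal.ofReal b * volume L ≤ volume C := by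
  obtain ⟨k, hkK, hk⟩ := hK.exists_isGreatest hK₀
  obtain ⟨l, hlL, hl⟩ := hL.exists_isLeast hL₀
  have scale : ∀ (c e : ℝ), 0 < c → ∀ S : Set ℝ,
      ENNReal.ofReal c * volume S = volume ((fun x => e + x) '' (c • S)) := by
    intro c e hc S
    rw [Set.image_add_left, measure_preimage_add, Measure.addHaar_smul]
    simp [abs_of_pos hc]
  rw [scale a (b * l) ha K, scale b (a * k) hb L, ← measure_inter_add_sdiff C
    (measurableSet_Iic (a := a * k + b * l))]
  gcongr ?_ + ?_
  · refine measure_mono ?_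
    rintro _ ⟨_, ⟨x, hx, rfl⟩, rfl⟩
    refine ⟨?_, ?_⟩
    · have := h x hx l hlL
      simpa [add_comm] using this
    · have : a * x ≤ a * k := by gcongr; exact hk hx
      simp only [smul_eq_mul, mem_Iic]; linarith
  · calc volume ((fun x => a * k + x) '' (b • L))
        ≤ volume ((C \ Iic (a * k + b * l)) ∪ {a * k + b * l}) := by
          refine measure_mono ?_
          rintro _ ⟨_, ⟨y, hy, rfl⟩, rfl⟩
          by_cases hyl : y = l
          · right; simp [hyl]
          · left
            refine ⟨by simpa using h k hkK y hy, ?_⟩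
            have : l < y := lt_of_le_of_ne (hl hy) (Ne.symm hyl)
            simp only [smul_eq_mul, mem_Iic, not_le]
            gcongr
      _ ≤ volume (C \ Iic (a * k + b * l)) + volume {a * k + b * l} := measure_union_le _ _
      _ = volume (C \ Iic (a * k + b * l)) := by simp

theorem volume_add_le {A B C : Set ℝ} (hA : MeasurableSet A) (hB : MeasurableSet B)
    (hA₀ : A.Nonempty) (hB₀ : B.Nonempty) (hAt : volume A ≠ ⊤) (hBt : volume B ≠ ⊤)
    {a b : ℝ} (ha : 0 < a) (hb : 0 < b) (h : ∀ x ∈ A, ∀ y ∈ B, a * x + b * y ∈ C) :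
    ENNReal.ofReal a * volume A + ENNReal.ofReal b * volume B ≤ volume C := by
  obtain ⟨x₀, hx₀⟩ := hA₀
  obtain ⟨y₀, hy₀⟩ := hB₀
  have approx : ∀ (S : Set ℝ), MeasurableSet S → volume S ≠ ⊤ → ∀ s ∈ S, ∀ ε : NNReal, 0 < ε →
      ∃ K ⊆ S, IsCompact K ∧ K.Nonempty ∧ volume S ≤ volume K + ε := by
    intro S hS hSt s hs ε hε
    obtain ⟨K, hKS, hK, hlt⟩ := hS.exists_isCompact_lt_add hSt (ε := ε) (by simpa using hε.ne')
    refine ⟨insert s K, insert_subset hs hKS, hK.insert s, insert_nonempty _ _, hlt.le.trans ?_⟩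
    gcongr
    exact subset_insert _ _
  have ineq : ∀ ε : NNReal, 0 < ε →
      ENNReal.ofReal a * volume A + ENNReal.ofReal b * volume B ≤
        volume C + (ENNReal.ofReal a + ENNReal.ofReal b) * ε := by
    intro ε hε
    obtain ⟨K, hKA, hK, hK₀, hKε⟩ := approx A hA hAt x₀ hx₀ ε hε
    obtain ⟨L, hLB, hL, hL₀, hLε⟩ := approx B hB hBt y₀ hy₀ ε hε
    calc ENNReal.ofReal a * volume A + ENNReal.ofReal b * volume B
        ≤ ENNReal.ofReal a * (volume K + ε) + ENNReal.ofReal b * (volume L + ε) := by gcongr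
      _ = (ENNReal.ofReal a * volume K + ENNReal.ofReal b * volume L) +
          (ENNReal.ofReal a + ENNReal.ofReal b) * ε := by ring
      _ ≤ _ := by
          gcongr
          exact volume_add_le_of_isCompact hK hL hK₀ hL₀ ha hb
            fun x hx y hy => h x (hKA hx) y (hLB hy)
  refine ENNReal.le_of_forall_pos_le_add fun ε hε _ => ?_
  have hab : 0 < a + b := by positivity
  have hab' : 0 < (a + b).toNNReal := Real.toNNReal_pos.2 hab
  have h' := ineq (ε / (a + b).toNNReal) (by positivity)
  rwa [← ENNReal.ofReal_add ha.le hb.le, ← ENNReal.ofNNReal_toNNReal (a + b), ← ENNReal.coe_mul,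
    mul_div_cancel₀ _ hab'.ne'] at h'

/-- Layer cake: for `t < 1` the superlevel sets of `f` and `g` are nonempty and combine into that of
`h`, since `t ^ a * t ^ b = t`, so the one-dimensional additive inequality applies at each level.
Both suprema must be `1` so that neither superlevel set is empty while the other is not. -/
theorem integral_add_le_of_sup_eq_one {f g h : ℝ → ℝ} (hf : Measurable f) (hg : Measurable g)
    (hf₀ : 0 ≤ f) (hg₀ : 0 ≤ g) (hh₀ : 0 ≤ h) (hfi : Integrable f) (hgi : Integrable g)
    (hhi : Integrable h) (hf₁ : ∀ x, f x ≤ 1) (hg₁ : ∀ x, g x ≤ 1)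
    (hfs : ∀ t < 1, ∃ x, t < f x) (hgs : ∀ t < 1, ∃ x, t < g x)
    {a b : ℝ} (ha : 0 < a) (hb : 0 < b) (hab : a + b = 1)
    (H : ∀ x y, f x ^ a * g y ^ b ≤ h (a * x + b * y)) :
    a * (∫ x, f x) + b * (∫ x, g x) ≤ ∫ x, h x := by
  have key : ENNReal.ofReal a * (∫⁻ x, ENNReal.ofReal (f x)) +
      ENNReal.ofReal b * (∫⁻ x, ENNReal.ofReal (g x)) ≤ ∫⁻ x, ENNReal.ofReal (h x) := by
    rw [lintegral_eq_lintegral_meas_lt _ (Filter.Eventually.of_forall hf₀) hf.aemeasurable,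
      lintegral_eq_lintegral_meas_lt _ (Filter.Eventually.of_forall hg₀) hg.aemeasurable,
      lintegral_eq_lintegral_meas_lt _ (Filter.Eventually.of_forall hh₀) hhi.aemeasurable,
      ← lintegral_const_mul' _ _ ENNReal.ofReal_ne_top,
      ← lintegral_const_mul' _ _ ENNReal.ofReal_ne_top, ← lintegral_add_left]
    · refine setLIntegral_mono' measurableSet_Ioi fun t ht => ?_
      rw [mem_Ioi] at ht
      rcases lt_or_ge t 1 with ht1 | ht1
      · refine volume_add_le (measurableSet_lt measurable_const hf)
          (measurableSet_lt measurable_const hg) (hfs t ht1) (hgs t ht1)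
          (hfi.measure_gt_lt_top ht).ne (hgi.measure_gt_lt_top ht).ne ha hb
          fun x hx y hy => ?_
        refine lt_of_lt_of_le ?_ (H x y)
        calc t = t ^ a * t ^ b := by rw [← Real.rpow_add ht, hab, Real.rpow_one]
          _ < f x ^ a * g y ^ b := by
            gcongr
            · exact hx
            · exact hy
      · have e1 : {x | t < f x} = ∅ := by
          ext x; simpa using (hf₁ x).trans ht1
        have e2 : {x | t < g x} = ∅ := by
          ext x; simpa using (hg₁ x).trans ht1
        simp [e1, e2]
    · refine Measurable.const_mul ?_ _
      exact (Antitone.measurable fun s t hst => measure_mono fun x (hx : t < f x) =>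
        lt_of_le_of_lt hst hx)
  rw [← ofReal_integral_eq_lintegral_ofReal hfi (Filter.Eventually.of_forall hf₀),
    ← ofReal_integral_eq_lintegral_ofReal hgi (Filter.Eventually.of_forall hg₀),
    ← ofReal_integral_eq_lintegral_ofReal hhi (Filter.Eventually.of_forall hh₀),
    ← ENNReal.ofReal_mul ha.le, ← ENNReal.ofReal_mul hb.le, ← ENNReal.ofReal_add,
    ENNReal.ofReal_le_ofReal_iff] at key
  · exact key
  · exact integral_nonneg hh₀
  · exact mul_nonneg ha.le (integral_nonneg hf₀)
  · exact mul_nonneg hb.le (integral_nonneg hg₀)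

/-- The Prékopa–Leindler inequality on the real line, for bounded functions. -/
theorem prekopa_leindler {f g h : ℝ → ℝ} (hf : Measurable f) (hg : Measurable g)
    (hf₀ : 0 ≤ f) (hg₀ : 0 ≤ g) (hh₀ : 0 ≤ h) (hfi : Integrable f) (hgi : Integrable g)
    (hhi : Integrable h) (hf₁ : BddAbove (range f)) (hg₁ : BddAbove (range g))
    {a b : ℝ} (ha : 0 < a) (hb : 0 < b) (hab : a + b = 1)
    (H : ∀ x y, f x ^ a * g y ^ b ≤ h (a * x + b * y)) :
    (∫ x, f x) ^ a * (∫ x, g x) ^ b ≤ ∫ x, h x := by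
  have hh : 0 ≤ ∫ x, h x := integral_nonneg hh₀
  have zero : ∀ u : ℝ → ℝ, 0 ≤ u → BddAbove (range u) → ¬ 0 < ⨆ x, u x → ∫ x, u x = 0 := by
    intro u hu hub hsup
    have : u = 0 := funext fun x => le_antisymm ((le_ciSup hub x).trans (not_lt.1 hsup)) (hu x)
    simp [this]
  by_cases hF : 0 < ⨆ x, f x
  swap; · simpa [zero f hf₀ hf₁ hF, Real.zero_rpow ha.ne'] using hh
  by_cases hG : 0 < ⨆ x, g x
  swap; · simpa [zero g hg₀ hg₁ hG, Real.zero_rpow hb.ne'] using hh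
  set F := ⨆ x, f x
  set G := ⨆ x, g x
  have hFG : 0 < F ^ a * G ^ b := by positivity
  -- After division by the suprema the additive inequality holds, and the weighted AM-GM inequality
  -- makes it multiplicative.
  have main := integral_add_le_of_sup_eq_one (f := fun x => f x / F) (g := fun x => g x / G)
    (h := fun x => h x / (F ^ a * G ^ b)) (hf.div_const _) (hg.div_const _)
    (fun x => div_nonneg (hf₀ x) hF.le) (fun x => div_nonneg (hg₀ x) hG.le)
    (fun x => div_nonneg (hh₀ x) hFG.le) (hfi.div_const _) (hgi.div_const _) (hhi.div_const _)
    (fun x => (div_le_one hF).2 (le_ciSup hf₁ x)) (fun x => (div_le_one hG).2 (le_ciSup hg₁ x))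
    (fun t ht => by
      obtain ⟨x, hx⟩ := exists_lt_of_lt_ciSup (f := f) (show t * F < F by nlinarith)
      exact ⟨x, (lt_div_iff₀ hF).2 hx⟩)
    (fun t ht => by
      obtain ⟨x, hx⟩ := exists_lt_of_lt_ciSup (f := g) (show t * G < G by nlinarith)
      exact ⟨x, (lt_div_iff₀ hG).2 hx⟩) ha hb hab
    (fun x y => by
      rw [Real.div_rpow (hf₀ x) hF.le, Real.div_rpow (hg₀ y) hG.le, div_mul_div_comm]
      gcongr
      exact H x y)
  simp only [integral_div] at main
  have If : 0 ≤ ∫ x, f x := integral_nonneg hf₀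
  have Ig : 0 ≤ ∫ x, g x := integral_nonneg hg₀
  have amgm := (Real.geom_mean_le_arith_mean2_weighted ha.le hb.le (div_nonneg If hF.le)
    (div_nonneg Ig hG.le) hab).trans main
  rwa [Real.div_rpow If hF.le, Real.div_rpow Ig hG.le, div_mul_div_comm,
    div_le_div_iff_of_pos_right hFG] at amgm

theorem measureReal_prod_eq_integral {E : Type*} [MeasurableSpace E] {μ : Measure E} [SFinite μ]
    {A : Set (ℝ × E)} (hA : MeasurableSet A) (hAt : (volume.prod μ) A ≠ ⊤) :
    (volume.prod μ).real A = ∫ s, μ.real (Prod.mk s ⁻¹' A) := by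
  rw [measureReal_def, Measure.prod_apply hA]
  exact (integral_toReal (measurable_measure_prodMk_left hA).aemeasurable
    (Measure.ae_measure_lt_top hA hAt)).symm

/-- The Brunn–Minkowski inequality in multiplicative form. -/
theorem brunn_minkowski {n : ℕ} {A B C : Set (Fin n → ℝ)} (hA : MeasurableSet A)
    (hB : MeasurableSet B) (hC : MeasurableSet C) {r : ℝ} (hAr : ∀ x ∈ A, ∀ i, |x i| ≤ r)
    (hBr : ∀ x ∈ B, ∀ i, |x i| ≤ r) (hCr : ∀ x ∈ C, ∀ i, |x i| ≤ r)
    {a b : ℝ} (ha : 0 < a) (hb : 0 < b) (hab : a + b = 1)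
    (H : ∀ x ∈ A, ∀ y ∈ B, a • x + b • y ∈ C) :
    volume.real A ^ a * volume.real B ^ b ≤ volume.real C := by
  induction n with
  | zero =>
    rcases A.eq_empty_or_nonempty with rfl | ⟨x, hx⟩
    · simp [Real.zero_rpow ha.ne']
    rcases B.eq_empty_or_nonempty with rfl | ⟨y, hy⟩
    · simp [Real.zero_rpow hb.ne']
    have hC1 : C = univ := (Set.nonempty_of_mem (H x hx y hy)).eq_univ
    have hA1 : A = univ := (Set.nonempty_of_mem hx).eq_univ
    have hB1 : B = univ := (Set.nonempty_of_mem hy).eq_univ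
    subst hC1 hA1 hB1
    simp [measureReal_def, volume_pi]
  | succ n ih =>
    let e := MeasurableEquiv.piFinSuccAbove (fun _ : Fin (n + 1) => ℝ) 0
    have he : MeasurePreserving e.symm volume volume :=
      (volume_preserving_piFinSuccAbove (fun _ : Fin (n + 1) => ℝ) 0).symm e
    have hes : ∀ s y, e.symm (s, y) = Fin.cons s y := fun s y => by
      simp [e, MeasurableEquiv.piFinSuccAbove]; rfl
    have fin : ∀ {m : ℕ} (S : Set (Fin m → ℝ)), (∀ x ∈ S, ∀ i, |x i| ≤ r) → volume S ≠ ⊤ := by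
      intro m S hS
      refine ((measure_mono (t := Icc (fun _ => -r) fun _ => r) fun x hx => ?_).trans_lt
        isCompact_Icc.measure_lt_top).ne
      exact ⟨fun i => (abs_le.1 (hS x hx i)).1, fun i => (abs_le.1 (hS x hx i)).2⟩
    let f : Set (Fin (n + 1) → ℝ) → ℝ → ℝ :=
      fun S s => volume.real (Prod.mk s ⁻¹' (e.symm ⁻¹' S))
    have hslice : ∀ S : Set (Fin (n + 1) → ℝ), MeasurableSet S → (∀ x ∈ S, ∀ i, |x i| ≤ r) →
        Measurable (f S) ∧ Integrable (f S) ∧ BddAbove (range (f S)) ∧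
          volume.real S = ∫ s, f S s ∧ ∀ s, ∀ x ∈ Prod.mk s ⁻¹' (e.symm ⁻¹' S), ∀ i, |x i| ≤ r := by
      intro S hS hSr
      have hS' : MeasurableSet (e.symm ⁻¹' S) := e.symm.measurable hS
      have hSv : volume (e.symm ⁻¹' S) = volume S := he.measure_preimage hS.nullMeasurableSet
      have hsl : ∀ s, ∀ x ∈ Prod.mk s ⁻¹' (e.symm ⁻¹' S), ∀ i, |x i| ≤ r := by
        intro s x hx i
        have := hSr _ hx i.succ
        rw [hes] at this
        simpa using this
      have hSt : volume (e.symm ⁻¹' S) ≠ ⊤ := hSv ▸ fin S hSr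
      refine ⟨(measurable_measure_prodMk_left hS').ennreal_toReal,
        Measure.integrable_measure_prodMk_left hS' hSt, ?_, ?_, hsl⟩
      · refine ⟨volume.real (Icc (fun _ : Fin n => -r) fun _ => r), ?_⟩
        rintro _ ⟨s, rfl⟩
        refine measureReal_mono (fun x hx => ?_) isCompact_Icc.measure_lt_top.ne
        exact ⟨fun i => (abs_le.1 (hsl s x hx i)).1, fun i => (abs_le.1 (hsl s x hx i)).2⟩
      · rw [measureReal_def, ← hSv]
        exact measureReal_prod_eq_integral hS' hSt
    obtain ⟨mA, iA, bA, vA, sA⟩ := hslice A hA hAr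
    obtain ⟨mB, iB, bB, vB, sB⟩ := hslice B hB hBr
    obtain ⟨mC, iC, -, vC, sC⟩ := hslice C hC hCr
    rw [vA, vB, vC]
    -- The slice volumes satisfy the Prékopa–Leindler hypothesis by the induction hypothesis.
    refine prekopa_leindler mA mB (fun _ => measureReal_nonneg) (fun _ => measureReal_nonneg)
      (fun _ => measureReal_nonneg) iA iB iC bA bB ha hb hab fun s t => ?_
    refine ih (measurable_prodMk_left (e.symm.measurable hA))
      (measurable_prodMk_left (e.symm.measurable hB))
      (measurable_prodMk_left (e.symm.measurable hC)) (sA s) (sB t) (sC _) fun x hx y hy => ?_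
    have hxy := H _ hx _ hy
    rw [hes, hes] at hxy
    simp only [mem_preimage, hes]
    convert hxy using 1
    ext i
    refine Fin.cases ?_ (fun j => ?_) i <;> simp

/-! ### Transfer of Brunn–Minkowski to Euclidean space. -/

theorem volume_real_preimage_toLp {d : ℕ} {S : Set (Vec d)} (hS : IsOpen S) :
    volume.real ((WithLp.toLp 2) ⁻¹' S : Set (Fin d → ℝ)) = volume.real S := by
  rw [measureReal_def, (PiLp.volume_preserving_toLp (Fin d)).measure_preimage
    hS.measurableSet.nullMeasurableSet, measureReal_def]

theorem brunn_minkowski_of_isOpen {d : ℕ} {A B C : Set (Vec d)} (hA : IsOpen A) (hB : IsOpen B)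
    (hC : IsOpen C) {r : ℝ} (hAr : A ⊆ Metric.closedBall 0 r) (hBr : B ⊆ Metric.closedBall 0 r)
    (hCr : C ⊆ Metric.closedBall 0 r) {a b : ℝ} (ha : 0 < a) (hb : 0 < b) (hab : a + b = 1)
    (H : ∀ x ∈ A, ∀ y ∈ B, a • x + b • y ∈ C) :
    volume.real A ^ a * volume.real B ^ b ≤ volume.real C := by
  have coord : ∀ S : Set (Vec d), S ⊆ Metric.closedBall 0 r →
      ∀ x ∈ (WithLp.toLp 2 ⁻¹' S : Set (Fin d → ℝ)), ∀ i, |x i| ≤ r := by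
    intro S hS x hx i
    have h1 := hS hx
    rw [mem_closedBall_zero_iff] at h1
    exact (PiLp.norm_apply_le (WithLp.toLp 2 x) i).trans h1
  have meas : ∀ S : Set (Vec d), IsOpen S →
      MeasurableSet (WithLp.toLp 2 ⁻¹' S : Set (Fin d → ℝ)) :=
    fun S hS => (WithLp.measurable_toLp 2 _) hS.measurableSet
  rw [← volume_real_preimage_toLp hA, ← volume_real_preimage_toLp hB, ← volume_real_preimage_toLp hC]
  exact brunn_minkowski (meas A hA) (meas B hB) (meas C hC) (coord A hAr) (coord B hBr)
    (coord C hCr) ha hb hab fun x hx y hy => H _ hx _ hy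

end OnlineImproper

namespace OnlineImproper

open MeasureTheory Set
open scoped Pointwise

/-! ### Grünbaum's inequality -/

/-- A monotone log-concave function on the line lies below an exponential that touches it. -/
theorem exists_le_mul_exp_of_logConcave {G : ℝ → ℝ} (hmono : Monotone G) (h₀ : ∀ t, 0 ≤ G t)
    (hlog : ∀ s t a b, 0 < a → 0 < b → a + b = 1 → G s ^ a * G t ^ b ≤ G (a * s + b * t))
    {s₀ m : ℝ} (hs₀ : s₀ < m) (hGs₀ : 0 < G s₀) :
    ∃ c, 0 ≤ c ∧ ∀ t, G t ≤ G m * Real.exp (c * (t - m)) := by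
  have hGm : 0 < G m := hGs₀.trans_le (hmono hs₀.le)
  have slope : ∀ s t, s < m → m < t → 0 < G s →
      (Real.log (G t) - Real.log (G m)) / (t - m) ≤
        (Real.log (G m) - Real.log (G s)) / (m - s) := by
    intro s t hs ht hGs
    have hGt : 0 < G t := hGm.trans_le (hmono ht.le)
    have hts : 0 < t - s := by linarith
    have key := hlog s t ((t - m) / (t - s)) ((m - s) / (t - s)) (div_pos (by linarith) hts)
      (div_pos (by linarith) hts) (by field_simp; ring)
    have e1 : (t - m) / (t - s) * s + (m - s) / (t - s) * t = m := by field_simp; ring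
    rw [e1] at key
    have key2 := Real.log_le_log (by positivity) key
    rw [Real.log_mul (by positivity) (by positivity), Real.log_rpow hGs, Real.log_rpow hGt] at key2
    have key3 : (t - m) * Real.log (G s) + (m - s) * Real.log (G t) ≤
        (t - s) * Real.log (G m) := by
      calc _ = (t - s) * ((t - m) / (t - s) * Real.log (G s) +
              (m - s) / (t - s) * Real.log (G t)) := by field_simp
        _ ≤ _ := by gcongr
    rw [div_le_div_iff₀ (by linarith) (by linarith)]
    linarith
  -- The supremum of the chord slopes of `log G` to the right of `m` serves as a supergradient at
  -- `m`; it is finite because of the chord from `s₀`.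
  let P : Set ℝ := (fun t => (Real.log (G t) - Real.log (G m)) / (t - m)) '' Ioi m
  have hPb : BddAbove P := ⟨(Real.log (G m) - Real.log (G s₀)) / (m - s₀), by
    rintro _ ⟨t, ht, rfl⟩
    exact slope s₀ t hs₀ ht hGs₀⟩
  have hPn : P.Nonempty := ⟨_, m + 1, by simp, rfl⟩
  have up : ∀ t, m < t → Real.log (G t) - Real.log (G m) ≤ sSup P * (t - m) := fun t ht => by
    rw [← div_le_iff₀ (by linarith)]
    exact le_csSup hPb ⟨t, ht, rfl⟩
  refine ⟨sSup P, ?_, fun t => ?_⟩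
  · have h1 := up (m + 1) (by linarith)
    have h2 := Real.log_le_log hGm (hmono (by linarith : m ≤ m + 1))
    linarith
  · rcases (h₀ t).eq_or_lt with h | hGt
    · rw [← h]; positivity
    have main : Real.log (G t) ≤ Real.log (G m) + sSup P * (t - m) := by
      rcases lt_trichotomy t m with ht | rfl | ht
      · have h1 : sSup P ≤ (Real.log (G m) - Real.log (G t)) / (m - t) := csSup_le hPn (by
          rintro _ ⟨u, hu, rfl⟩
          exact slope t u ht hu hGt)
        rw [le_div_iff₀ (by linarith)] at h1
        linarith
      · simp
      · linarith [up t ht]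
    calc G t = Real.exp (Real.log (G t)) := (Real.exp_log hGt).symm
      _ ≤ Real.exp (Real.log (G m) + sSup P * (t - m)) := Real.exp_le_exp.2 main
      _ = _ := by rw [Real.exp_add, Real.exp_log hGm]

variable {d : ℕ}

theorem IsCentroid.setIntegral_inner {S : Set (Vec d)} {w : Vec d} (hw : IsCentroid S w)
    (hS : volume S ≠ 0) {r : ℝ} (hSr : S ⊆ Metric.closedBall 0 r) (a : Vec d) :
    ∫ x in S, ⟪x, a⟫ = volume.real S * ⟪w, a⟫ := by
  have hSt : volume S ≠ ⊤ := ((measure_mono hSr).trans_lt measure_closedBall_lt_top).ne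
  have hint : IntegrableOn (fun x : Vec d => x) S :=
    ((continuous_id.locallyIntegrable (μ := volume)).integrableOn_isCompact
      (isCompact_closedBall 0 r)).mono_set hSr
  have h1 : ∫ x in S, ⟪x, a⟫ = ⟪∫ x in S, x, a⟫ := by
    rw [real_inner_comm, ← integral_inner hint a]
    simp only [real_inner_comm]
  rw [h1, hw.1 hS, real_inner_smul_left, ← measureReal_def, ← mul_assoc, mul_inv_cancel₀, one_mul]
  exact (ENNReal.toReal_pos hS hSt).ne'

/-- A functional cannot stay above its mean on an open set: moving slightly along `a` gives strict
excess on an open subset, hence a positive integral of the difference. -/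
theorem exists_mem_inner_lt_of_setIntegral_eq {U : Set (Vec d)} (hU : IsOpen U)
    (hU₀ : U.Nonempty) {r : ℝ} (hUr : U ⊆ Metric.closedBall 0 r) {a : Vec d} (ha : a ≠ 0) {m : ℝ}
    (hm : ∫ x in U, ⟪x, a⟫ = volume.real U * m) : ∃ x ∈ U, ⟪x, a⟫ < m := by
  by_contra! hcon
  have hUt : volume U ≠ ⊤ := ((measure_mono hUr).trans_lt measure_closedBall_lt_top).ne
  have hint : IntegrableOn (fun x : Vec d => ⟪x, a⟫) U :=
    (((by fun_prop : Continuous fun x : Vec d => ⟪x, a⟫).locallyIntegrable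
      (μ := volume)).integrableOn_isCompact (isCompact_closedBall 0 r)).mono_set hUr
  have hci : IntegrableOn (fun _ : Vec d => m) U := integrableOn_const hUt
  have hzero : ∫ x in U, (⟪x, a⟫ - m) = 0 := by
    rw [integral_sub hint hci, hm, setIntegral_const, smul_eq_mul, sub_self]
  have hpos : 0 < ∫ x in U, (⟪x, a⟫ - m) := by
    rw [setIntegral_pos_iff_support_of_nonneg_ae
      ((ae_restrict_iff' hU.measurableSet).2 (Filter.Eventually.of_forall fun x hx =>
        sub_nonneg.2 (hcon x hx))) (hint.sub hci)]
    obtain ⟨x, hx⟩ := hU₀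
    have hsub : U ∩ {x | m < ⟪x, a⟫} ⊆ (Function.support fun x : Vec d => ⟪x, a⟫ - m) ∩ U :=
      fun y hy => ⟨(sub_pos.2 hy.2).ne', hy.1⟩
    refine lt_of_lt_of_le (IsOpen.measure_pos _ ?_ ?_) (measure_mono hsub)
    · exact hU.inter (isOpen_lt continuous_const (by fun_prop))
    · have hc : Filter.Tendsto (fun t : ℝ => x + t • a) (nhdsWithin 0 (Ioi 0)) (nhds x) := by
        have : Continuous fun t : ℝ => x + t • a := by fun_prop
        simpa using (this.tendsto 0).mono_left nhdsWithin_le_nhds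
      obtain ⟨t, ht, ht0⟩ := ((hc.eventually (hU.mem_nhds hx)).and self_mem_nhdsWithin).exists
      refine ⟨x + t • a, ht, ?_⟩
      have h1 : 0 < ⟪a, a⟫ := real_inner_self_pos.2 ha
      have h2 := hcon x hx
      have h3 : 0 < t * ⟪a, a⟫ := mul_pos ht0 h1
      simp only [mem_ofPred_eq, inner_add_left, real_inner_smul_left]
      linarith
  exact hpos.ne' hzero

/-- The centroid of a bounded open convex set lies in the set. -/
theorem mem_of_setIntegral_inner_eq {U : Set (Vec d)} (hU : IsOpen U) (hUc : Convex ℝ U)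
    (hU₀ : U.Nonempty) {r : ℝ} (hUr : U ⊆ Metric.closedBall 0 r) {w : Vec d}
    (hw : ∀ a, ∫ x in U, ⟪x, a⟫ = volume.real U * ⟪w, a⟫) : w ∈ U := by
  by_contra hwU
  obtain ⟨f, hf⟩ := geometric_hahn_banach_open_point hUc hU hwU
  have hrep : ∀ x, f x = ⟪x, (InnerProductSpace.toDual ℝ (Vec d)).symm f⟫ := fun x => by
    rw [real_inner_comm, InnerProductSpace.toDual_symm_apply]
  set a := (InnerProductSpace.toDual ℝ (Vec d)).symm f
  have ha : a ≠ 0 := by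
    rintro h0
    obtain ⟨x, hx⟩ := hU₀
    have := hf x hx
    simp [hrep, h0] at this
  obtain ⟨x, hx, hlt⟩ := exists_mem_inner_lt_of_setIntegral_eq hU hU₀ hUr (neg_ne_zero.2 ha) (hw (-a))
  have := hf x hx
  rw [hrep, hrep] at this
  simp only [inner_neg_right] at hlt
  linarith

/-- Grünbaum's inequality: a half-space that contains the centroid contains a fraction of at least
`1 / e` of the volume. -/
theorem grunbaum_of_isOpen {U : Set (Vec d)} (hU : IsOpen U) (hUc : Convex ℝ U) (hU₀ : U.Nonempty)
    {r : ℝ} (hUr : U ⊆ Metric.closedBall 0 r) {a : Vec d} (ha : a ≠ 0) {m : ℝ}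
    (hm : ∫ x in U, ⟪x, a⟫ = volume.real U * m) :
    Real.exp (-1) * volume.real U ≤ volume.real (U ∩ {x | ⟪x, a⟫ < m}) := by
  have hUt : volume U ≠ ⊤ := ((measure_mono hUr).trans_lt measure_closedBall_lt_top).ne
  have hUpos : 0 < volume.real U := ENNReal.toReal_pos (hU.measure_pos _ hU₀).ne' hUt
  have hsubt : ∀ T : Set (Vec d), volume (U ∩ T) ≠ ⊤ := fun T =>
    ((measure_mono inter_subset_left).trans_lt hUt.lt_top).ne
  have hopen : ∀ t : ℝ, IsOpen (U ∩ {x | ⟪x, a⟫ < t}) := fun t =>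
    hU.inter (isOpen_lt (by fun_prop) continuous_const)
  set V := volume.real U with hV
  let G : ℝ → ℝ := fun t => volume.real (U ∩ {x | ⟪x, a⟫ < t})
  have hG₀ : ∀ t, 0 ≤ G t := fun t => measureReal_nonneg
  have hGV : ∀ t, G t ≤ V := fun t => measureReal_mono inter_subset_left hUt
  have hmono : Monotone G := fun s t hst => measureReal_mono
    (fun x hx => ⟨hx.1, lt_of_lt_of_le hx.2 hst⟩) (hsubt _)
  have hlog : ∀ s t a b, 0 < a → 0 < b → a + b = 1 → G s ^ a * G t ^ b ≤ G (a * s + b * t) := by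
    intro s t p q hp hq hpq
    refine brunn_minkowski_of_isOpen (hopen s) (hopen t) (hopen _) (inter_subset_left.trans hUr)
      (inter_subset_left.trans hUr) (inter_subset_left.trans hUr) hp hq hpq ?_
    rintro x ⟨hxU, hx⟩ y ⟨hyU, hy⟩
    refine ⟨hUc hxU hyU hp.le hq.le hpq, ?_⟩
    simp only [mem_ofPred_eq, inner_add_left, real_inner_smul_left] at hx hy ⊢
    have h1 := mul_lt_mul_of_pos_left hx hp
    have h2 := mul_lt_mul_of_pos_left hy hq
    linarith
  obtain ⟨x₀, hx₀U, hx₀⟩ := exists_mem_inner_lt_of_setIntegral_eq hU hU₀ hUr ha hm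
  obtain ⟨s₀, hs₀, hs₀m⟩ := exists_between hx₀
  have hGs₀ : 0 < G s₀ :=
    ENNReal.toReal_pos ((hopen s₀).measure_pos _ ⟨x₀, hx₀U, hs₀⟩).ne' (hsubt _)
  have hGm : 0 < G m := hGs₀.trans_le (hmono hs₀m.le)
  obtain ⟨c, hc₀, hc⟩ := exists_le_mul_exp_of_logConcave hmono hG₀ hlog hs₀m hGs₀
  let M : ℝ := r * ‖a‖ + 1
  have hM : ∀ x ∈ U, ⟪x, a⟫ < M := fun x hx => by
    have h1 := real_inner_le_norm x a
    have h2 : ‖x‖ * ‖a‖ ≤ r * ‖a‖ := by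
      gcongr
      exact mem_closedBall_zero_iff.1 (hUr hx)
    simp only [M]; linarith
  have hGM : G M = V := by
    simp only [G, V]
    congr 1
    exact inter_eq_left.2 hM
  have hVM : V ≤ G m * Real.exp (c * (M - m)) := hGM ▸ hc M
  rcases hc₀.eq_or_lt with rfl | hcpos
  · have h1 : Real.exp (-1) ≤ 1 := Real.exp_le_one_iff.2 (by norm_num)
    simp only [zero_mul, Real.exp_zero, mul_one] at hVM
    nlinarith
  -- `t₀` is where the exponential bound reaches `V`
  let t₀ : ℝ := m + Real.log (V / G m) / c
  have ht₀ : G m * Real.exp (c * (t₀ - m)) = V := by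
    have : c * (t₀ - m) = Real.log (V / G m) := by simp only [t₀]; field_simp; ring
    rw [this, Real.exp_log (by positivity)]
    field_simp
  have ht₀M : t₀ ≤ M := by
    by_contra! hlt
    have : G m * Real.exp (c * (M - m)) < G m * Real.exp (c * (t₀ - m)) := by gcongr
    linarith
  have hint : IntegrableOn (fun x : Vec d => ⟪x, a⟫) U :=
    (((by fun_prop : Continuous fun x : Vec d => ⟪x, a⟫).locallyIntegrable
      (μ := volume)).integrableOn_isCompact (isCompact_closedBall 0 r)).mono_set hUr
  have hci : IntegrableOn (fun _ : Vec d => M) U := integrableOn_const hUt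
  have hdi : Integrable (fun x : Vec d => M - ⟪x, a⟫) (volume.restrict U) := hci.sub hint
  have hmean : ∫ x in U, (M - ⟪x, a⟫) = V * (M - m) := by
    rw [integral_sub hci hint, hm, setIntegral_const, smul_eq_mul]; ring
  have hnn : 0 ≤ᵐ[volume.restrict U] fun x => M - ⟪x, a⟫ :=
    (ae_restrict_iff' hU.measurableSet).2 (Filter.Eventually.of_forall fun x hx =>
      (sub_pos.2 (hM x hx)).le)
  have htail : ∫⁻ t in Ioi (M - t₀), ENNReal.ofReal (V * Real.exp (c * (M - t - t₀))) =
      ENNReal.ofReal (V / c) := by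
    have e1 : ∀ t, V * Real.exp (c * (M - t - t₀)) =
        (V * Real.exp (c * (M - t₀))) * Real.exp (-c * t) := fun t => by
      rw [mul_assoc, ← Real.exp_add]; ring_nf
    have hI : IntegrableOn (fun t => V * Real.exp (c * (M - t - t₀))) (Ioi (M - t₀)) := by
      simp only [e1]
      exact (integrableOn_exp_mul_Ioi (neg_lt_zero.2 hcpos) _).const_mul _
    rw [← ofReal_integral_eq_lintegral_ofReal hI
      (Filter.Eventually.of_forall fun t => by positivity)]
    simp only [e1]
    rw [integral_const_mul, integral_exp_mul_Ioi (neg_lt_zero.2 hcpos)]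
    congr 1
    rw [neg_div_neg_eq, mul_div_assoc', mul_assoc, ← Real.exp_add]
    simp
  -- Layer cake for `M - ⟪x, a⟫` gives `∫ G (M - t)` over `t > 0`. Bound `G` by `V` above `t₀` and
  -- by the exponential below it. The result `t₀ - m ≤ 1 / c` says that the exponential grows at
  -- most by a factor `e` between `m` and `t₀`.
  have hupper : ENNReal.ofReal (V * (M - m)) ≤
      ENNReal.ofReal (V * (M - t₀)) + ENNReal.ofReal (V / c) := by
    rw [← hmean, ofReal_integral_eq_lintegral_ofReal hdi hnn,
      lintegral_eq_lintegral_meas_lt _ hnn hdi.aemeasurable]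
    have e2 : ∀ t, (volume.restrict U) {x | t < M - ⟪x, a⟫} = ENNReal.ofReal (G (M - t)) := by
      intro t
      rw [Measure.restrict_apply' hU.measurableSet, ofReal_measureReal (hsubt _), inter_comm]
      congr 2
      ext x
      simp only [mem_ofPred_eq]
      constructor <;> intro h <;> linarith
    simp only [e2]
    rw [← Ioc_union_Ioi_eq_Ioi (sub_nonneg.2 ht₀M), ← htail]
    refine (lintegral_union_le _ _ _).trans ?_
    gcongr ?_ + ?_
    · calc ∫⁻ t in Ioc 0 (M - t₀), ENNReal.ofReal (G (M - t))
          ≤ ∫⁻ t in Ioc 0 (M - t₀), ENNReal.ofReal V :=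
            lintegral_mono fun t => ENNReal.ofReal_le_ofReal (hGV _)
        _ = ENNReal.ofReal (V * (M - t₀)) := by
            simp [ENNReal.ofReal_mul hUpos.le]
    · refine lintegral_mono fun t => ENNReal.ofReal_le_ofReal ?_
      calc G (M - t) ≤ G m * Real.exp (c * (M - t - m)) := hc _
        _ = G m * Real.exp (c * (t₀ - m)) * Real.exp (c * (M - t - t₀)) := by
          rw [mul_assoc, ← Real.exp_add]; ring_nf
        _ = _ := by rw [ht₀]
  rw [← ENNReal.ofReal_add (mul_nonneg hUpos.le (sub_nonneg.2 ht₀M)) (by positivity),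
    ENNReal.ofReal_le_ofReal_iff (add_nonneg (mul_nonneg hUpos.le (sub_nonneg.2 ht₀M))
      (by positivity))] at hupper
  have hle : c * (t₀ - m) ≤ 1 := by
    have h1 : V * (t₀ - m) ≤ V * (1 / c) := by
      rw [mul_one_div]; linarith
    have h2 := le_of_mul_le_mul_left h1 hUpos
    rwa [le_div_iff₀ hcpos, mul_comm] at h2
  calc Real.exp (-1) * V = G m * (Real.exp (-1) * Real.exp (c * (t₀ - m))) := by
        rw [← ht₀]; ring
    _ ≤ G m * (Real.exp (-1) * Real.exp 1) := by gcongr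
    _ = G m := by rw [← Real.exp_add]; simp

/-! ### From open sets to arbitrary bounded convex sets. -/

theorem volume_interior_eq {S : Set (Vec d)} (hS : Convex ℝ S) :
    volume (interior S) = volume S :=
  measure_congr (interior_ae_eq_of_null_frontier (hS.addHaar_frontier volume))

/-- Keeps every query inside the cone, where the oracle's guarantee applies. -/
theorem IsCentroid.mem {S : Set (Vec d)} {w : Vec d} (hw : IsCentroid S w) (hS : Convex ℝ S)
    {r : ℝ} (hSr : S ⊆ Metric.closedBall 0 r) : w ∈ S := by
  by_cases h0 : volume S = 0
  · exact hw.2 h0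
  have hvol := volume_interior_eq hS
  refine interior_subset (mem_of_setIntegral_inner_eq isOpen_interior hS.interior ?_
    (interior_subset.trans hSr) fun a => ?_)
  · by_contra hemp
    rw [not_nonempty_iff_eq_empty] at hemp
    rw [hemp, measure_empty] at hvol
    exact h0 hvol.symm
  · rw [setIntegral_congr_set (interior_ae_eq_of_null_frontier (hS.addHaar_frontier volume)),
      hw.setIntegral_inner h0 hSr, measureReal_def, measureReal_def, hvol]

theorem grunbaum {S : Set (Vec d)} {w a : Vec d} (hw : IsCentroid S w) (hS : Convex ℝ S)
    {r : ℝ} (hSr : S ⊆ Metric.closedBall 0 r) (ha : a ≠ 0) (hwa : ⟪w, a⟫ ≤ 0) :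
    volume.real (S ∩ {u | 0 ≤ ⟪u, a⟫}) ≤ (1 - Real.exp (-1)) * volume.real S := by
  have hSt : volume S ≠ ⊤ := ((measure_mono hSr).trans_lt measure_closedBall_lt_top).ne
  by_cases h0 : volume S = 0
  · have h1 : volume.real S = 0 := by simp [measureReal_def, h0]
    have h2 : volume.real (S ∩ {u | 0 ≤ ⟪u, a⟫}) ≤ volume.real S :=
      measureReal_mono inter_subset_left hSt
    simpa [h1] using h2
  have hae := interior_ae_eq_of_null_frontier (hS.addHaar_frontier volume)
  have hvol := volume_interior_eq hS
  have hVr : volume.real (interior S) = volume.real S := by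
    rw [measureReal_def, measureReal_def, hvol]
  have hne : (interior S).Nonempty := by
    by_contra hemp
    rw [not_nonempty_iff_eq_empty] at hemp
    rw [hemp, measure_empty] at hvol
    exact h0 hvol.symm
  have hmain := grunbaum_of_isOpen isOpen_interior hS.interior hne (interior_subset.trans hSr) ha
    (m := ⟪w, a⟫) (by rw [setIntegral_congr_set hae, hw.setIntegral_inner h0 hSr, hVr])
  have hle : volume.real (interior S ∩ {x | ⟪x, a⟫ < ⟪w, a⟫}) ≤
      volume.real (S \ {u | 0 ≤ ⟪u, a⟫}) := by
    refine measureReal_mono ?_ ((measure_mono sdiff_subset).trans_lt hSt.lt_top).ne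
    rintro x ⟨hx, hxa⟩
    exact ⟨interior_subset hx, fun h => absurd (lt_of_lt_of_le hxa hwa) (not_lt.2 h)⟩
  have hsplit := measureReal_inter_add_sdiff (μ := volume) (s := S)
    (t := {u : Vec d | 0 ≤ ⟪u, a⟫})
    ((isClosed_le continuous_const (by fun_prop)).measurableSet) hSt
  rw [hVr] at hmain
  linarith

end OnlineImproper

namespace OnlineImproper

open Set Filter Topology

variable {d : ℕ}

/-! ### Bregman divergences and projections -/

theorem hasDerivAt_comp_line {φ : Vec d → ℝ} {z v : Vec d} (h : DifferentiableAt ℝ φ z) :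
    HasDerivAt (fun t : ℝ => φ (z + t • v)) ⟪∇ φ z, v⟫ 0 := by
  have h1 : HasDerivAt (fun t : ℝ => z + t • v) v 0 := by
    simpa using ((hasDerivAt_id (0 : ℝ)).smul_const v).const_add z
  have h2 : HasFDerivAt φ (InnerProductSpace.toDual ℝ (Vec d) (∇ φ z)) (z + (0 : ℝ) • v) := by
    simpa using h.hasGradientAt.hasFDerivAt
  have h3 := h2.comp_hasDerivAt (0 : ℝ) h1
  rwa [InnerProductSpace.toDual_apply_apply] at h3

/-- Let the weight of `x` in the strong convexity inequality tend to `0`. With `μ = 0` this is the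
gradient inequality for convex functions. -/
theorem half_mul_sq_le_bregman {D : Set (Vec d)} {φ : Vec d → ℝ} {μ : ℝ}
    (hφ : StrongConvexOn D μ φ) {x z : Vec d} (hx : x ∈ D) (hz : z ∈ D)
    (hd : DifferentiableAt ℝ φ z) : μ / 2 * ‖x - z‖ ^ 2 ≤ bregman φ x z := by
  have hslope := (hasDerivAt_comp_line (v := x - z) hd).tendsto_slope_zero_right
  simp only [zero_add, zero_smul, add_zero, smul_eq_mul] at hslope
  have hlim : Tendsto (fun t : ℝ => φ x - φ z - (1 - t) * (μ / 2 * ‖x - z‖ ^ 2)) (𝓝[>] 0)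
      (𝓝 (φ x - φ z - (1 - 0) * (μ / 2 * ‖x - z‖ ^ 2))) :=
    ((by fun_prop : Continuous fun t : ℝ =>
      φ x - φ z - (1 - t) * (μ / 2 * ‖x - z‖ ^ 2)).tendsto 0).mono_left nhdsWithin_le_nhds
  have hle := le_of_tendsto_of_tendsto hslope hlim (by
    filter_upwards [Ioo_mem_nhdsGT (show (0 : ℝ) < 1 by norm_num)] with t ht
    have h1 := hφ.2 hx hz ht.1.le (sub_nonneg.2 ht.2.le) (by ring : t + (1 - t) = 1)
    have h2 : t • x + (1 - t) • z = z + t • (x - z) := by module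
    rw [h2] at h1
    simp only [smul_eq_mul] at h1
    rw [inv_mul_le_iff₀ ht.1]
    linarith)
  unfold bregman
  linarith

theorem mul_sq_le_inner_gradient_sub {D : Set (Vec d)} {φ : Vec d → ℝ} {μ : ℝ}
    (hφ : StrongConvexOn D μ φ) {x z : Vec d} (hx : x ∈ D) (hz : z ∈ D)
    (hdx : DifferentiableAt ℝ φ x) (hdz : DifferentiableAt ℝ φ z) :
    μ * ‖x - z‖ ^ 2 ≤ ⟪∇ φ x - ∇ φ z, x - z⟫ := by
  have h1 := half_mul_sq_le_bregman hφ hx hz hdz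
  have h2 := half_mul_sq_le_bregman hφ hz hx hdx
  rw [norm_sub_rev z x] at h2
  unfold bregman at h1 h2
  simp only [inner_sub_left, inner_sub_right] at h1 h2 ⊢
  linarith

theorem bregman_three_point (φ : Vec d → ℝ) (x z z' : Vec d) :
    bregman φ x z = bregman φ x z' + bregman φ z' z + ⟪∇ φ z' - ∇ φ z, x - z'⟫ := by
  unfold bregman
  simp only [inner_sub_left, inner_sub_right]
  ring

theorem inner_gradient_sub_nonneg_of_isMinOn {C : Set (Vec d)} (hC : Convex ℝ C) {φ : Vec d → ℝ}
    {z z' u : Vec d} (hz' : z' ∈ C) (hu : u ∈ C) (hd : DifferentiableAt ℝ φ z')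
    (hmin : IsMinOn (fun u => bregman φ u z) C z') : 0 ≤ ⟪∇ φ z' - ∇ φ z, u - z'⟫ := by
  have h1 := hasDerivAt_comp_line (v := u - z') hd
  have h2 : HasDerivAt (fun t : ℝ => bregman φ (z' + t • (u - z')) z)
      (⟪∇ φ z', u - z'⟫ - ⟪∇ φ z, u - z'⟫) 0 := by
    have h3 : HasDerivAt (fun t : ℝ => ⟪∇ φ z, z' - z⟫ + t * ⟪∇ φ z, u - z'⟫)
        ⟪∇ φ z, u - z'⟫ 0 := by
      simpa using ((hasDerivAt_id (0 : ℝ)).mul_const ⟪∇ φ z, u - z'⟫).const_add ⟪∇ φ z, z' - z⟫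
    refine ((h1.sub_const (φ z)).sub h3).congr_of_eventuallyEq (Eventually.of_forall fun t => ?_)
    simp only [bregman, Pi.sub_apply, inner_sub_right, inner_add_right, real_inner_smul_right]
    ring
  have hslope := h2.tendsto_slope_zero_right
  simp only [zero_add, zero_smul, add_zero, smul_eq_mul] at hslope
  rw [inner_sub_left]
  refine ge_of_tendsto hslope ?_
  filter_upwards [Ioo_mem_nhdsGT (show (0 : ℝ) < 1 by norm_num)] with t ht
  refine mul_nonneg (inv_nonneg.2 ht.1.le) (sub_nonneg.2 (hmin ?_))
  have h4 : z' + t • (u - z') = (1 - t) • z' + t • u := by module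
  rw [h4]
  exact hC hz' hu (sub_nonneg.2 ht.2.le) ht.1.le (by ring)

theorem convex_halfSpace (w v : Vec d) : Convex ℝ {u : Vec d | 0 ≤ ⟪w, u - v⟫} := by
  intro x hx y hy a b ha hb hab
  have h1 : a • x + b • y - v = a • (x - v) + b • (y - v) := by
    have h2 : v = (a + b) • v := by rw [hab, one_smul]
    conv_lhs => rw [h2]
    module
  simp only [mem_ofPred_eq] at hx hy ⊢
  rw [h1, inner_add_right, real_inner_smul_right, real_inner_smul_right]
  positivity

/-- The Pythagorean inequality: by the three-point identity the difference is `D_φ(z', z)` plus a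
term that is non-negative by first-order optimality. -/
theorem IsBregmanProj.bregman_le {D : Set (Vec d)} (hD : Convex ℝ D) {φ : Vec d → ℝ} {μ : ℝ}
    (hμ : 0 ≤ μ) (hφ : StrongConvexOn D μ φ) (hd : ∀ x ∈ interior D, DifferentiableAt ℝ φ x)
    {w v z z' x : Vec d} (hz : z ∈ interior D)
    (h : IsBregmanProj D φ {u | 0 ≤ ⟪w, u - v⟫} z z') (hx : x ∈ D) (hxv : ⟪w, v⟫ ≤ ⟪w, x⟫) :
    bregman φ x z' ≤ bregman φ x z := by
  have h1 := inner_gradient_sub_nonneg_of_isMinOn (hD.inter (convex_halfSpace w v))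
    (u := x) ⟨interior_subset h.1, h.2.1⟩ ⟨hx, by simpa [inner_sub_right] using hxv⟩ (hd _ h.1) h.2.2
  have h2 := half_mul_sq_le_bregman hφ (interior_subset h.1) (interior_subset hz) (hd z hz)
  have h3 : 0 ≤ μ / 2 * ‖z' - z‖ ^ 2 := by positivity
  rw [bregman_three_point φ x z z']
  linarith

/-- A linear functional that is non-negative on a half-space is a multiple of its normal. -/
theorem eq_smul_of_forall_inner_nonneg {w g : Vec d} (h : ∀ v, 0 ≤ ⟪w, v⟫ → 0 ≤ ⟪g, v⟫) :
    ∃ c : ℝ, 0 ≤ c ∧ g = c • w := by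
  have hgw := h w real_inner_self_nonneg
  refine ⟨⟪g, w⟫ / ⟪w, w⟫, div_nonneg hgw real_inner_self_nonneg, ?_⟩
  set c := ⟪g, w⟫ / ⟪w, w⟫
  have hc : c * ⟪w, w⟫ = ⟪g, w⟫ := by
    by_cases hw : w = 0
    · simp [hw]
    · exact div_mul_cancel₀ _ (inner_self_ne_zero.2 hw)
  have horth : ⟪w, g - c • w⟫ = 0 := by
    rw [inner_sub_right, real_inner_smul_right, hc, real_inner_comm, sub_self]
  have h1 := h (-(g - c • w)) (by rw [inner_neg_right, horth, neg_zero])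
  have h2 : ⟪g - c • w, g - c • w⟫ = ⟪g, g - c • w⟫ := by
    rw [inner_sub_left (x := g), real_inner_smul_left, horth, mul_zero, sub_zero]
  rw [inner_neg_right, ← h2] at h1
  exact sub_eq_zero.1 (inner_self_eq_zero.1 (le_antisymm (by linarith) real_inner_self_nonneg))

/-- A Lagrange multiplier: as `z'` is interior to `D`, short steps in any direction `e` with `⟪w, e⟫
≥ 0` are feasible, whether or not the constraint is active. -/
theorem IsBregmanProj.exists_gradient_sub_eq_smul {D : Set (Vec d)} (hD : Convex ℝ D)
    {φ : Vec d → ℝ} (hd : ∀ x ∈ interior D, DifferentiableAt ℝ φ x) {w v z z' : Vec d}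
    (h : IsBregmanProj D φ {u | 0 ≤ ⟪w, u - v⟫} z z') :
    ∃ c : ℝ, 0 ≤ c ∧ ∇ φ z' - ∇ φ z = c • w := by
  refine eq_smul_of_forall_inner_nonneg fun e he => ?_
  have hcont : Tendsto (fun t : ℝ => z' + t • e) (𝓝[>] 0) (𝓝 z') := by
    have : Continuous fun t : ℝ => z' + t • e := by fun_prop
    simpa using (this.tendsto 0).mono_left nhdsWithin_le_nhds
  obtain ⟨t, htD, ht : 0 < t⟩ := ((hcont.eventually_mem (isOpen_interior.mem_nhds h.1)).and
    self_mem_nhdsWithin).exists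
  have hH : z' + t • e ∈ {u | 0 ≤ ⟪w, u - v⟫} := by
    have h1 : 0 ≤ ⟪w, z' - v⟫ := h.2.1
    have h2 : z' + t • e - v = (z' - v) + t • e := by abel
    simp only [mem_ofPred_eq]
    rw [h2, inner_add_right, real_inner_smul_right]
    positivity
  have h1 := inner_gradient_sub_nonneg_of_isMinOn (hD.inter (convex_halfSpace w v))
    (u := z' + t • e) ⟨interior_subset h.1, h.2.1⟩ ⟨interior_subset htD, hH⟩ (hd _ h.1) h.2.2
  rw [add_sub_cancel_left, real_inner_smul_right] at h1
  exact nonneg_of_mul_nonneg_right h1 ht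

/-! ### Consequences of the PNIP property -/

theorem mul_sq_le_inner_hessian {D : Set (Vec d)} {φ : Vec d → ℝ} {μ : ℝ}
    (hφ : StrongConvexOn D μ φ) (hd : ∀ x ∈ interior D, DifferentiableAt ℝ φ x) {x : Vec d}
    (hx : x ∈ interior D) (hdd : DifferentiableAt ℝ (∇ φ) x) (v : Vec d) :
    μ * ‖v‖ ^ 2 ≤ ⟪hessian φ x v, v⟫ := by
  have hline : HasDerivAt (fun t : ℝ => x + t • v) v 0 := by
    simpa using ((hasDerivAt_id (0 : ℝ)).smul_const v).const_add x
  have h1 : HasFDerivAt (∇ φ) (hessian φ x) (x + (0 : ℝ) • v) := by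
    rw [zero_smul, add_zero]
    exact hdd.hasFDerivAt
  have hslope := (h1.comp_hasDerivAt (0 : ℝ) hline).tendsto_slope_zero_right
  simp only [Function.comp_def, zero_add, zero_smul, add_zero] at hslope
  have hslope' := hslope.inner (tendsto_const_nhds (x := v)) (𝕜 := ℝ)
  refine ge_of_tendsto hslope' ?_
  have hcont : Tendsto (fun t : ℝ => x + t • v) (𝓝[>] 0) (𝓝 x) := by
    simpa using hline.continuousAt.tendsto.mono_left nhdsWithin_le_nhds
  filter_upwards [hcont.eventually_mem (isOpen_interior.mem_nhds hx), self_mem_nhdsWithin] with t htD ht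
  rw [mem_Ioi] at ht
  have h2 := mul_sq_le_inner_gradient_sub hφ (interior_subset htD) (interior_subset hx) (hd _ htD)
    (hd x hx)
  rw [add_sub_cancel_left, real_inner_smul_right, norm_smul, mul_pow, Real.norm_eq_abs,
    sq_abs] at h2
  rw [real_inner_smul_left, le_inv_mul_iff₀ ht]
  refine le_of_mul_le_mul_left ?_ ht
  linarith

theorem mul_sq_le_inner_of_mem_convexHull {s : Set (Vec d →L[ℝ] Vec d)} {μ : ℝ}
    (hs : ∀ H ∈ s, ∀ v, μ * ‖v‖ ^ 2 ≤ ⟪H v, v⟫) {H : Vec d →L[ℝ] Vec d}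
    (hH : H ∈ convexHull ℝ s) (v : Vec d) : μ * ‖v‖ ^ 2 ≤ ⟪H v, v⟫ := by
  have hconv : Convex ℝ {H : Vec d →L[ℝ] Vec d | μ * ‖v‖ ^ 2 ≤ ⟪H v, v⟫} := by
    intro A hA B hB a b ha hb hab
    simp only [mem_ofPred_eq, add_apply, smul_apply,
      inner_add_left, real_inner_smul_left] at hA hB ⊢
    calc μ * ‖v‖ ^ 2 = a * (μ * ‖v‖ ^ 2) + b * (μ * ‖v‖ ^ 2) := by rw [← add_mul, hab, one_mul]
      _ ≤ _ := by gcongr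
  exact convexHull_min (fun A hA => hs A hA v) hconv hH

/-- The mean value theorem for vector fields: an increment lies in the closed convex hull of the
directional derivatives. -/
theorem sub_mem_closure_convexHull {U : Set (Vec d)} (hU : Convex ℝ U) {g : Vec d → Vec d}
    (hg : ∀ x ∈ U, DifferentiableAt ℝ g x) {z z' : Vec d} (hz : z ∈ U) (hz' : z' ∈ U) :
    g z' - g z ∈ closure ((fun H : Vec d →L[ℝ] Vec d => H (z' - z)) ''
      convexHull ℝ (fderiv ℝ g '' U)) := by
  by_contra hnot
  have hconv : Convex ℝ ((fun H : Vec d →L[ℝ] Vec d => H (z' - z)) ''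
      convexHull ℝ (fderiv ℝ g '' U)) :=
    (convex_convexHull ℝ _).linear_image
      (ContinuousLinearMap.apply ℝ (Vec d) (z' - z) : (Vec d →L[ℝ] Vec d) →ₗ[ℝ] Vec d)
  -- The scalar mean value theorem for `f ∘ g` along the segment contradicts the separation.
  obtain ⟨f, c, hlt, hc⟩ := geometric_hahn_banach_closed_point hconv.closure isClosed_closure hnot
  have hmem : ∀ t ∈ Icc (0 : ℝ) 1, z + t • (z' - z) ∈ U := fun t ht => by
    have : z + t • (z' - z) = (1 - t) • z + t • z' := by module
    rw [this]
    exact hU hz hz' (sub_nonneg.2 ht.2) ht.1 (by ring)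
  have hder : ∀ t ∈ Icc (0 : ℝ) 1, HasDerivAt (fun t : ℝ => f (g (z + t • (z' - z))))
      (f (fderiv ℝ g (z + t • (z' - z)) (z' - z))) t := fun t ht => by
    have hline : HasDerivAt (fun t : ℝ => z + t • (z' - z)) (z' - z) t := by
      simpa using ((hasDerivAt_id t).smul_const (z' - z)).const_add z
    exact f.hasFDerivAt.comp_hasDerivAt t
      ((hg _ (hmem t ht)).hasFDerivAt.comp_hasDerivAt t hline)
  obtain ⟨t, ht, heq⟩ := exists_hasDerivAt_eq_slope (fun t : ℝ => f (g (z + t • (z' - z))))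
    (fun t => f (fderiv ℝ g (z + t • (z' - z)) (z' - z))) zero_lt_one
    (fun t ht => (hder t ht).continuousAt.continuousWithinAt)
    (fun t ht => hder t (Ioo_subset_Icc_self ht))
  have h1 := hlt _ (subset_closure ⟨_, subset_convexHull ℝ _
    ⟨_, hmem t (Ioo_subset_Icc_self ht), rfl⟩, rfl⟩)
  simp only [one_smul, zero_smul, add_zero, add_sub_cancel, sub_zero, div_one, ← map_sub] at heq h1
  rw [heq] at h1
  linarith

/-- Ideally `z' - z = H⁻¹ u` for an averaged Hessian `H`, with `u` the gradient increment. The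
Hessian need not be continuous, so the mean value theorem only gives `H` in the convex hull with `H
(z' - z)` close to `u`. Coercivity `μ‖s‖² ≤ ⟪H s, s⟫` bounds the error `s` after inversion,
uniformly in `H`. -/
theorem PNIP.inner_sub_nonneg {D : Set (Vec d)} {φ : Vec d → ℝ} {W : PointedCone ℝ (Vec d)}
    (h : PNIP D φ W) {μ : ℝ} (hμ : 0 < μ) (hφ : StrongConvexOn D μ φ) {z z' : Vec d}
    (hz : z ∈ interior D) (hz' : z' ∈ interior D) (hgrad : ∇ φ z' - ∇ φ z ∈ W) {w : Vec d}
    (hw : w ∈ W) : 0 ≤ ⟪w, z' - z⟫ := by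
  have hmean := sub_mem_closure_convexHull h.legendre.convex.interior h.twiceDifferentiable hz hz'
  refine le_of_forall_pos_le_add fun ε hε => ?_
  obtain ⟨_, ⟨H, hH, rfl⟩, hdist⟩ := Metric.mem_closure_iff.1 hmean (ε * μ / (‖w‖ + 1)) (by positivity)
  obtain ⟨hinv, hpos⟩ := h.inner_nonneg H hH
  rw [dist_eq_norm] at hdist
  simp only at hdist
  set u := ∇ φ z' - ∇ φ z
  set s := z' - z - H.inverse u
  have hHs : H s = H (z' - z) - u := by
    rw [map_sub, hinv.self_apply_inverse]
  have hlow := mul_sq_le_inner_of_mem_convexHull (s := hessian φ '' interior D) (by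
    rintro _ ⟨x, hx, rfl⟩ v
    exact mul_sq_le_inner_hessian hφ h.legendre.differentiable hx (h.twiceDifferentiable x hx) v)
    hH s
  have hs : μ * ‖s‖ ≤ ε * μ / (‖w‖ + 1) := by
    rcases (norm_nonneg s).eq_or_lt with h0 | h0
    · rw [← h0, mul_zero]; positivity
    · refine le_of_mul_le_mul_right ?_ h0
      calc μ * ‖s‖ * ‖s‖ = μ * ‖s‖ ^ 2 := by ring
        _ ≤ ⟪H s, s⟫ := hlow
        _ ≤ ‖H s‖ * ‖s‖ := real_inner_le_norm _ _
        _ ≤ _ := by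
          gcongr
          rw [hHs, norm_sub_rev]
          exact hdist.le
  have hs' : ‖w‖ * ‖s‖ ≤ ε := by
    rw [le_div_iff₀ (by positivity)] at hs
    have h1 : μ * (‖w‖ * ‖s‖ + ‖s‖) ≤ μ * ε := by linarith
    have h2 := le_of_mul_le_mul_left h1 hμ
    linarith [norm_nonneg s]
  have h1 : ⟪w, z' - z⟫ = ⟪w, H.inverse u⟫ + ⟪w, s⟫ := by
    rw [← inner_add_right]; simp [s]
  have h2 := hpos w hw u hgrad
  have h3 := (abs_le.1 (abs_real_inner_le_norm w s)).1
  linarith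

/-! ### Minimizers of Legendre functions -/

/-- If a minimizer were on the boundary, gradients along a segment from it into the interior would
stay bounded, against the blow-up condition. -/
theorem IsLegendre.mem_interior_of_isMinOn {D : Set (Vec d)} {φ : Vec d → ℝ}
    (hL : IsLegendre D φ) (hconv : StrongConvexOn D 0 φ) (hD : (interior D).Nonempty) {y : Vec d}
    (hy : y ∈ D) (hmin : IsMinOn φ D y) : y ∈ interior D := by
  by_contra hyi
  have hfront : y ∈ frontier D := ⟨subset_closure hy, hyi⟩
  obtain ⟨p, hp⟩ := hD
  obtain ⟨r, hr, hball⟩ := Metric.nhds_basis_closedBall.mem_iff.1 (isOpen_interior.mem_nhds hp)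
  obtain ⟨M, hM⟩ := (isCompact_closedBall p r).exists_bound_of_continuousOn
    (f := φ) (fun x hx => (hL.differentiable x (hball hx)).continuousAt.continuousWithinAt)
  let u : ℕ → Vec d := fun n => y + (1 / ((n : ℝ) + 1)) • (p - y)
  have hu : ∀ n, u n ∈ interior D := fun n => by
    refine hL.convex.add_smul_sub_mem_interior' (subset_closure hy) hp ⟨by positivity, ?_⟩
    rw [div_le_one (by positivity)]
    linarith [Nat.cast_nonneg (α := ℝ) n]
  have hlim : Tendsto u atTop (𝓝 y) := by
    have h := ((tendsto_one_div_add_atTop_nhds_zero_nat (𝕜 := ℝ)).smul_const (p - y)).const_add y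
    rwa [zero_smul, add_zero] at h
  have hbound : ∀ n, ‖∇ φ (u n)‖ ≤ (M - φ y) / r := by
    intro n
    have hun := interior_subset (hu n)
    have hdn := hL.differentiable _ (hu n)
    set g := ∇ φ (u n)
    have ht : (0 : ℝ) < 1 / ((n : ℝ) + 1) := by positivity
    have ht1 : 1 / ((n : ℝ) + 1) ≤ 1 := by
      rw [div_le_one (by positivity)]
      linarith [Nat.cast_nonneg (α := ℝ) n]
    have h1 := half_mul_sq_le_bregman hconv hy hun hdn
    have h2 : y - u n = (-(1 / ((n : ℝ) + 1))) • (p - y) := by simp only [u]; module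
    have h3 : p - u n = (1 - 1 / ((n : ℝ) + 1)) • (p - y) := by simp only [u]; module
    have h4 : φ y ≤ φ (u n) := hmin hun
    simp only [bregman, zero_div, zero_mul] at h1
    rw [h2, real_inner_smul_right] at h1
    have h5 : 0 ≤ ⟪g, p - y⟫ := nonneg_of_mul_nonneg_right (by linarith) ht
    have h6 : 0 ≤ ⟪g, p - u n⟫ := by
      rw [h3, real_inner_smul_right]
      exact mul_nonneg (by linarith) h5
    rcases (norm_nonneg g).eq_or_lt with h0 | h0
    · rw [← h0]
      have h7 := (abs_le.1 (hM p (Metric.mem_closedBall_self hr.le))).2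
      have h8 : φ y ≤ φ p := hmin (interior_subset hp)
      exact div_nonneg (by linarith) hr.le
    -- Testing convexity at the point of the ball furthest in direction `g` gives `φ y + r‖g‖ ≤ M`.
    · have hq : p + (r / ‖g‖) • g ∈ Metric.closedBall p r := by
        rw [mem_closedBall_iff_norm, add_sub_cancel_left, norm_smul, norm_div, norm_norm,
          Real.norm_eq_abs, abs_of_pos hr, div_mul_cancel₀ _ h0.ne']
      have h7 := half_mul_sq_le_bregman hconv (interior_subset (hball hq)) hun hdn
      have h8 := (abs_le.1 (hM _ hq)).2
      have h9 : p + (r / ‖g‖) • g - u n = (p - u n) + (r / ‖g‖) • g := by abel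
      simp only [bregman, zero_div, zero_mul] at h7
      rw [h9, inner_add_right, real_inner_smul_right, real_inner_self_eq_norm_sq] at h7
      have h10 : r / ‖g‖ * ‖g‖ ^ 2 = ‖g‖ * r := by field_simp
      rw [le_div_iff₀ hr]
      linarith
  have hblow := hL.gradient_blowup u hu y hfront hlim
  obtain ⟨n, hn⟩ := (hblow.eventually_gt_atTop ((M - φ y) / r)).exists
  exact absurd (hbound n) (not_le.2 hn)

theorem gradient_eq_zero_of_isMinOn {D : Set (Vec d)} {φ : Vec d → ℝ} {y : Vec d}
    (hy : y ∈ interior D) (hmin : IsMinOn φ D y) : ∇ φ y = 0 := by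
  have h1 := (hmin.isLocalMin (mem_interior_iff_mem_nhds.1 hy)).fderiv_eq_zero
  simp [gradient, h1]

end OnlineImproper

namespace OnlineImproper

open MeasureTheory Set Filter Topology
open scoped Pointwise

variable {d : ℕ} {R ε : ℝ} {D : Set (Vec d)} {φ : Vec d → ℝ} {W : PointedCone ℝ (Vec d)}
  {O : Vec d → Vec d} {y z : Vec d} {S : Set (Vec d)} {V : List (Vec d)}

/-! ### Invariants of the projection-and-decomposition loop -/

theorem PADLoop.convex_and_subset (h : PADLoop R ε D φ W O y z S V) :
    Convex ℝ S ∧ S ⊆ (W : Set (Vec d)) ∩ Metric.closedBall 0 1 := by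
  induction h with
  | start => exact ⟨W.convex.inter (convex_closedBall 0 1), subset_rfl⟩
  | @step z z' w S V _ _ _ _ ih =>
    refine ⟨ih.1.inter ?_, inter_subset_left.trans ih.2⟩
    have h1 := convex_halfSpace (O w - z') 0
    simpa only [sub_zero, real_inner_comm] using h1

theorem PADLoop.centroid_mem (h : PADLoop R ε D φ W O y z S V) {w : Vec d}
    (hw : IsCentroid S w) : w ∈ S :=
  hw.mem h.convex_and_subset.1 (h.convex_and_subset.2.trans inter_subset_right)

theorem PADLoop.mem_interior (h : PADLoop R ε D φ W O y z S V) (hy : y ∈ interior D) :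
    z ∈ interior D := by
  induction h with
  | start => exact hy
  | step _ _ _ proj _ => exact proj.1

theorem PADLoop.mem_of_mem {K Kstar : Set (Vec d)} (hO : IsImproperOracle K Kstar W O)
    (h : PADLoop R ε D φ W O y z S V) : ∀ v ∈ V, v ∈ K := by
  induction h with
  | start => simp
  | step prev _ centroid _ ih =>
    intro v hv
    rcases List.mem_append.1 hv with hv | hv
    · exact ih v hv
    · rw [List.mem_singleton.1 hv]
      exact (hO _ (prev.convex_and_subset.2 (prev.centroid_mem centroid)).1).1

theorem PADLoop.bregman_le {K Kstar : Set (Vec d)} (hO : IsImproperOracle K Kstar W O)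
    (hL : IsLegendre D φ) {μ : ℝ} (hμ : 0 ≤ μ) (hφ : StrongConvexOn D μ φ)
    (h : PADLoop R ε D φ W O y z S V) (hy : y ∈ interior D) {x : Vec d} (hx : x ∈ Kstar)
    (hxD : x ∈ D) : bregman φ x z ≤ bregman φ x y := by
  induction h with
  | start => exact le_rfl
  | step prev _ centroid proj ih =>
    refine le_trans ?_ ih
    exact proj.bregman_le hL.convex hμ hφ hL.differentiable (prev.mem_interior hy) hxD
      ((hO _ (prev.convex_and_subset.2 (prev.centroid_mem centroid)).1).2 x hx)

/-- Each projection moves the current point in a direction of the dual cone. -/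
theorem PADLoop.inner_proj_sub_nonneg (hP : PNIP D φ W) {μ : ℝ} (hμ : 0 < μ)
    (hφ : StrongConvexOn D μ φ) (h : PADLoop R ε D φ W O y z S V) (hy : y ∈ interior D)
    {w z' u : Vec d} (hw : IsCentroid S w)
    (proj : IsBregmanProj D φ {u | 0 ≤ ⟪w, u - O w⟫} z z') (hu : u ∈ W) : 0 ≤ ⟪u, z' - z⟫ := by
  obtain ⟨c, hc, hgrad⟩ := proj.exists_gradient_sub_eq_smul hP.legendre.convex
    hP.legendre.differentiable
  refine hP.inner_sub_nonneg hμ hφ (h.mem_interior hy) proj.1 ?_ hu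
  rw [hgrad]
  exact W.smul_mem hc (h.convex_and_subset.2 (h.centroid_mem hw)).1

/-- Cuts are made with earlier points `z`, but `⟪u, z⟫` never decreases for `u ∈ W`, so the
inequalities at the final point imply all earlier ones. -/
theorem PADLoop.mem_of_forall_inner_nonneg (hP : PNIP D φ W) {μ : ℝ} (hμ : 0 < μ)
    (hφ : StrongConvexOn D μ φ) (h : PADLoop R ε D φ W O y z S V) (hy : y ∈ interior D)
    {u : Vec d} (hu : u ∈ W) (hu₁ : ‖u‖ ≤ 1) (hpos : ∀ v ∈ V, 0 ≤ ⟪u, v - z⟫) : u ∈ S := by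
  induction h with
  | start => exact ⟨hu, by simpa using hu₁⟩
  | @step z z' w S V prev _ centroid proj ih =>
    have hmove := prev.inner_proj_sub_nonneg hP hμ hφ hy centroid proj hu
    refine ⟨ih fun v hv => ?_, hpos _ (by simp)⟩
    have h1 := hpos v (by simp [hv])
    have h2 : v - z = (v - z') + (z' - z) := by abel
    rw [h2, inner_add_right]
    linarith

theorem one_sub_exp_neg_one_pos : 0 < 1 - Real.exp (-1) :=
  sub_pos.2 (by simp)

theorem PADLoop.volume_le (hP : PNIP D φ W) {μ : ℝ} (hμ : 0 < μ)
    (hφ : StrongConvexOn D μ φ) (h : PADLoop R ε D φ W O y z S V) (hy : y ∈ interior D)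
    {u : Vec d} (hu : u ∈ W) (hpos : ∀ v ∈ V, 0 < ⟪u, v - z⟫) :
    volume.real S ≤ (1 - Real.exp (-1)) ^ V.length *
      volume.real ((W : Set (Vec d)) ∩ Metric.closedBall 0 1) := by
  induction h with
  | start => simp
  | @step z z' w S V prev _ centroid proj ih =>
    have hmove := prev.inner_proj_sub_nonneg hP hμ hφ hy centroid proj hu
    have h1 := ih fun v hv => by
      have h1 := hpos v (by simp [hv])
      have h2 : v - z = (v - z') + (z' - z) := by abel
      rw [h2, inner_add_right]
      linarith
    -- A zero normal would cut nothing; `u` excludes this. Feasibility of `z'` puts the centroid on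
    -- the discarded side or on its boundary.
    have hne : O w - z' ≠ 0 := fun h0 => by simpa [h0] using hpos (O w) (by simp)
    have hcut := grunbaum centroid prev.convex_and_subset.1
      (prev.convex_and_subset.2.trans inter_subset_right) hne (by
        have h2 : 0 ≤ ⟪w, z' - O w⟫ := proj.2.1
        rw [← neg_sub, inner_neg_right]
        linarith)
    rw [List.length_append, List.length_singleton, pow_succ', mul_assoc]
    exact hcut.trans (mul_le_mul_of_nonneg_left h1 one_sub_exp_neg_one_pos.le)

/-! ### The approximation guarantee -/

theorem inner_nonneg_of_forall_norm_le {e h : Vec d}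
    (H : ∀ t ∈ Ioo (0 : ℝ) 1, ‖e‖ ≤ ‖e + t • h‖) : 0 ≤ ⟪e, h⟫ := by
  have hlim : Tendsto (fun t : ℝ => 2 * ⟪e, h⟫ + t * ‖h‖ ^ 2) (𝓝[>] 0)
      (𝓝 (2 * ⟪e, h⟫ + 0 * ‖h‖ ^ 2)) :=
    ((by fun_prop : Continuous fun t : ℝ => 2 * ⟪e, h⟫ + t * ‖h‖ ^ 2).tendsto 0).mono_left
      nhdsWithin_le_nhds
  have h0 := ge_of_tendsto (b := 0) hlim (by
    filter_upwards [Ioo_mem_nhdsGT (show (0 : ℝ) < 1 by norm_num)] with t ht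
    have h1 := pow_le_pow_left₀ (norm_nonneg e) (H t ht) 2
    rw [norm_add_sq_real, real_inner_smul_right, norm_smul, mul_pow, Real.norm_eq_abs,
      sq_abs] at h1
    have h2 : 0 ≤ t * (2 * ⟪e, h⟫ + t * ‖h‖ ^ 2) := by linarith
    exact nonneg_of_mul_nonneg_right h2 ht.1)
  linarith

/-- The bipolar theorem; the closure appears because `W` need not be closed. -/
theorem mem_closure_of_forall_innerDual {e : Vec d}
    (h : ∀ c ∈ ProperCone.innerDual (W : Set (Vec d)), 0 ≤ ⟪e, c⟫) :
    e ∈ closure (W : Set (Vec d)) := by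
  let C : ProperCone ℝ (Vec d) := Submodule.closure W
  have hC : (C : Set (Vec d)) = closure (W : Set (Vec d)) := rfl
  have he : e ∈ ProperCone.innerDual (ProperCone.innerDual (C : Set (Vec d)) : Set (Vec d)) := by
    rw [ProperCone.mem_innerDual]
    intro c hc
    rw [real_inner_comm]
    refine h c ?_
    rw [ProperCone.mem_innerDual]
    exact fun w hw => ProperCone.mem_innerDual.1 hc (hC ▸ subset_closure hw)
  rw [ProperCone.innerDual_innerDual] at he
  exact he

/-- If the distance of `x` from the convex hull of the `v i` plus the dual cone exceeds `ε`, then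
some direction in the cone certifies this. -/
theorem exists_mem_cone_forall_lt_inner {n : ℕ} [NeZero n] {v : Fin n → Vec d} {x c : Vec d}
    {p : Fin n → ℝ} (hp : p ∈ stdSimplex ℝ (Fin n))
    (hc : c ∈ ProperCone.innerDual (W : Set (Vec d)))
    (hmin : ∀ q ∈ stdSimplex ℝ (Fin n), ∀ c' ∈ ProperCone.innerDual (W : Set (Vec d)),
      ‖∑ i, p i • v i + c - x‖ ≤ ‖∑ i, q i • v i + c' - x‖)
    (hε : 0 < ε) (hlt : ε < ‖∑ i, p i • v i + c - x‖) :
    ∃ u ∈ W, ‖u‖ ≤ 1 ∧ ∀ i, ε < ⟪u, v i - x⟫ := by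
  set s := ∑ i, p i • v i with hs
  set e := s + c - x with he
  have hsmul : ∀ t : ℝ, 0 ≤ t → ∀ c' ∈ ProperCone.innerDual (W : Set (Vec d)),
      t • c' ∈ ProperCone.innerDual (W : Set (Vec d)) := by
    intro t ht c' hc'
    rw [ProperCone.mem_innerDual] at hc' ⊢
    intro w hw
    rw [real_inner_smul_right]
    exact mul_nonneg ht (hc' hw)
  have hdual : ∀ c' ∈ ProperCone.innerDual (W : Set (Vec d)), 0 ≤ ⟪e, c'⟫ := by
    intro c' hc'
    refine inner_nonneg_of_forall_norm_le fun t ht => ?_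
    have h1 := hmin p hp (c + t • c') (add_mem hc (hsmul t ht.1.le c' hc'))
    have h2 : e + t • c' = s + (c + t • c') - x := by rw [he]; abel
    rwa [h2]
  have hec : ⟪e, c⟫ ≤ 0 := by
    have h0 : 0 ≤ ⟪e, -c⟫ := inner_nonneg_of_forall_norm_le fun t ht => by
      have h1 := hmin p hp ((1 - t) • c) (hsmul _ (sub_nonneg.2 ht.2.le) c hc)
      have h2 : e + t • -c = s + (1 - t) • c - x := by rw [he]; module
      rwa [h2]
    rw [inner_neg_right] at h0
    linarith
  -- Optimality of `p` against a shift of mass to vertex `i`, together with `⟪e, c⟫ ≤ 0`.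
  have hv : ∀ i, ‖e‖ ^ 2 ≤ ⟪e, v i - x⟫ := by
    intro i
    have h0 : 0 ≤ ⟪e, v i - s⟫ := inner_nonneg_of_forall_norm_le fun t ht => by
      have h1 := hmin ((1 - t) • p + t • Pi.single i 1) (convex_stdSimplex ℝ _ hp
        (single_mem_stdSimplex ℝ i) (sub_nonneg.2 ht.2.le) ht.1.le (by ring)) c hc
      have h3 : ∑ j, ((1 - t) • p + t • Pi.single i 1 : Fin n → ℝ) j • v j =
          (1 - t) • s + t • v i := by
        simp only [Pi.add_apply, Pi.smul_apply, add_smul, Finset.sum_add_distrib, smul_assoc,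
          ← Finset.smul_sum, ← hs]
        congr 2
        rw [Finset.sum_eq_single i]
        · simp
        · intro j _ hj; simp [hj]
        · simp
      have h2 : e + t • (v i - s) = (1 - t) • s + t • v i + c - x := by rw [he]; module
      rwa [h2, ← h3]
    have h4 : v i - x = (v i - s) + (e - c) := by rw [he]; abel
    rw [h4, inner_add_right, inner_sub_right e e c, real_inner_self_eq_norm_sq]
    linarith
  have heW := mem_closure_of_forall_innerDual hdual
  -- The residual `e` is only in the closure of `W`. These conditions are open and scale-invariant,
  -- so a nearby point of `W` satisfies them and can be normalized.
  have hopen : IsOpen {u : Vec d | ∀ i, ε * ‖u‖ < ⟪u, v i - x⟫} := by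
    simp only [ofPred_forall]
    exact isOpen_iInter_of_finite fun i => isOpen_lt (by fun_prop) (by fun_prop)
  have hemem : e ∈ {u : Vec d | ∀ i, ε * ‖u‖ < ⟪u, v i - x⟫} := fun i => by
    refine lt_of_lt_of_le ?_ (hv i)
    rw [sq]
    exact mul_lt_mul_of_pos_right hlt (hε.trans hlt)
  obtain ⟨u, hu, huW⟩ := mem_closure_iff.1 heW _ hopen hemem
  have hu0 : 0 < ‖u‖ := norm_pos_iff.2 fun h0 => by simpa [h0] using hu 0
  refine ⟨‖u‖⁻¹ • u, W.smul_mem (by positivity) huW, ?_, fun i => ?_⟩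
  · rw [norm_smul, norm_inv, norm_norm, inv_mul_cancel₀ hu0.ne']
  · rw [real_inner_smul_left, lt_inv_mul_iff₀ hu0, mul_comm]
    exact hu i

theorem volume_cone_inter_ball_pos (hW : (interior (W : Set (Vec d))).Nonempty) :
    0 < volume.real ((W : Set (Vec d)) ∩ Metric.closedBall 0 1) := by
  refine ENNReal.toReal_pos ?_
    ((measure_mono inter_subset_right).trans_lt measure_closedBall_lt_top).ne
  intro h0
  obtain ⟨q, hq⟩ := hW
  let c : ℝ := ‖q‖ + 1
  have hc : 0 < c := by positivity
  have hopen : IsOpen (interior (W : Set (Vec d)) ∩ Metric.ball 0 c) :=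
    isOpen_interior.inter Metric.isOpen_ball
  have hpos := hopen.measure_pos volume ⟨q, hq, by simp [c]⟩
  have hsub : interior (W : Set (Vec d)) ∩ Metric.ball 0 c ⊆
      c • ((W : Set (Vec d)) ∩ Metric.closedBall 0 1) := by
    rintro u ⟨hu, huc⟩
    refine ⟨c⁻¹ • u, ⟨W.smul_mem (by positivity) (interior_subset hu), ?_⟩, ?_⟩
    · rw [mem_closedBall_zero_iff, norm_smul, norm_inv, Real.norm_of_nonneg hc.le,
        inv_mul_le_iff₀ hc, mul_one]
      exact (mem_ball_zero_iff.1 huc).le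
    · simp [smul_smul, hc.ne']
  have h1 := hpos.trans_le (measure_mono hsub)
  rw [Measure.addHaar_smul, h0, mul_zero] at h1
  exact lt_irrefl _ h1

/-- The source of the constant `5` in the loop guard: `e < 5` gives `1 - 1/e < 4/5 ≤ exp(-1/5)`. -/
theorem one_sub_exp_neg_one_lt : 1 - Real.exp (-1) < Real.exp (-(1 / 5)) := by
  have h1 := Real.exp_one_lt_d9
  have h2 : (1 / 5 : ℝ) < Real.exp (-1) := by
    rw [Real.exp_neg, one_div]
    exact inv_strictAnti₀ (Real.exp_pos 1) (by linarith)
  have h3 := Real.add_one_le_exp (-(1 / 5) : ℝ)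
  linarith

theorem PADReturns.norm_le {K Kstar : Set (Vec d)} (hO : IsImproperOracle K Kstar W O)
    (hKR : K ⊆ Metric.closedBall 0 R) (hR : 0 < R) (hε : 0 < ε) (hεR : ε ≤ R)
    (hW : (interior (W : Set (Vec d))).Nonempty) (hP : PNIP D φ W) {μ : ℝ} (hμ : 0 < μ)
    (hφ : StrongConvexOn D μ φ) (hy : y ∈ interior D) {x : Vec d} {p : Fin V.length → ℝ}
    (h : PADReturns R ε D φ W O y x V p) :
    ∃ c ∈ ProperCone.innerDual (W : Set (Vec d)), ‖∑ i, p i • V.get i + c - x‖ ≤ ε := by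
  obtain ⟨⟨S, hloop⟩, hguard, hp, c, hc, hmin⟩ := h
  refine ⟨c, hc, ?_⟩
  by_contra! hlt
  have hlen : V.length ≠ 0 := by
    intro h0
    have hemp : IsEmpty (Fin V.length) := by rw [h0]; infer_instance
    have := hp.2
    rw [Finset.univ_eq_empty, Finset.sum_empty] at this
    exact zero_ne_one this
  have : NeZero V.length := ⟨hlen⟩
  obtain ⟨u, huW, hu₁, hu⟩ := exists_mem_cone_forall_lt_inner hp hc hmin hε hlt
  have huV : ∀ v ∈ V, ε < ⟪u, v - x⟫ := fun v hv => by
    obtain ⟨i, rfl⟩ := List.get_of_mem hv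
    exact hu i
  set W₁ := (W : Set (Vec d)) ∩ Metric.closedBall 0 1
  have hW₁ : 0 < volume.real W₁ := volume_cone_inter_ball_pos hW
  have hden : 0 < 2 * (R + ‖x‖) := by positivity
  -- The guard's logarithm is `log (1 / δ)`. Perturbing `(1 - δ) • u` by `δ • w` costs at most `δ (R
  -- + ‖x‖) = ε / 2`, while `(1 - δ) ε ≥ ε / 2`; hence the requirement `ε ≤ R`.
  set δ : ℝ := ε / (2 * (R + ‖x‖)) with hδ
  have hδ₀ : 0 < δ := by positivity
  have hδ₁ : δ ≤ 1 / 2 := by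
    rw [hδ, div_le_iff₀ hden]
    linarith [norm_nonneg x]
  have hδε : δ * (R + ‖x‖) = ε / 2 := by rw [hδ]; field_simp
  have hsub : (fun w => (1 - δ) • u + w) '' (δ • W₁) ⊆ S := by
    rintro _ ⟨_, ⟨w, ⟨hwW, hw₁⟩, rfl⟩, rfl⟩
    rw [mem_closedBall_zero_iff] at hw₁
    refine hloop.mem_of_forall_inner_nonneg hP hμ hφ hy (W.add_mem
      (W.smul_mem (by linarith) huW) (W.smul_mem hδ₀.le hwW)) ?_ fun v hv => ?_
    · calc ‖(1 - δ) • u + δ • w‖ ≤ ‖(1 - δ) • u‖ + ‖δ • w‖ := norm_add_le _ _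
        _ = (1 - δ) * ‖u‖ + δ * ‖w‖ := by
          rw [norm_smul, norm_smul, Real.norm_of_nonneg hδ₀.le, Real.norm_of_nonneg (by linarith)]
        _ ≤ (1 - δ) * 1 + δ * 1 := by gcongr; linarith
        _ = 1 := by ring
    · simp only [inner_add_left, real_inner_smul_left]
      have h1 : (1 - δ) * ε ≤ (1 - δ) * ⟪u, v - x⟫ := by
        gcongr
        · linarith
        · exact (huV v hv).le
      have h2 : -(R + ‖x‖) ≤ ⟪w, v - x⟫ := by
        have h3 := (abs_le.1 (abs_real_inner_le_norm w (v - x))).1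
        have h4 : ‖w‖ * ‖v - x‖ ≤ 1 * (R + ‖x‖) := by
          gcongr
          exact (norm_sub_le _ _).trans (by
            gcongr
            exact mem_closedBall_zero_iff.1 (hKR (hloop.mem_of_mem hO v hv)))
        linarith
      have h5 := mul_le_mul_of_nonneg_left h2 hδ₀.le
      nlinarith
  have hSt : volume S ≠ ⊤ :=
    ((measure_mono (hloop.convex_and_subset.2.trans inter_subset_right)).trans_lt
      measure_closedBall_lt_top).ne
  have hlower : δ ^ d * volume.real W₁ ≤ volume.real S := by
    refine le_trans (le_of_eq ?_) (measureReal_mono hsub hSt)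
    rw [measureReal_def, measureReal_def, image_add_left, measure_preimage_add,
      Measure.addHaar_smul, finrank_euclideanSpace_fin, abs_of_pos (by positivity),
      ENNReal.toReal_mul, ENNReal.toReal_ofReal (by positivity)]
  have hupper := hloop.volume_le hP hμ hφ hy huW fun v hv => hε.trans (huV v hv)
  have hcmp : δ ^ d ≤ (1 - Real.exp (-1)) ^ V.length :=
    le_of_mul_le_mul_right (hlower.trans hupper) hW₁
  have hstrict : (1 - Real.exp (-1)) ^ V.length < Real.exp (-(1 / 5)) ^ V.length :=
    pow_lt_pow_left₀ one_sub_exp_neg_one_lt one_sub_exp_neg_one_pos.le hlen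
  have hlog : Real.log δ = -Real.log (2 * (R + ‖x‖) / ε) := by
    rw [← Real.log_inv, inv_div]
  have hexp : Real.exp (-(1 / 5)) ^ V.length ≤ δ ^ d := by
    rw [← Real.exp_nat_mul, ← Real.exp_log (pow_pos hδ₀ d), Real.log_pow, Real.exp_le_exp, hlog]
    have h1 := not_lt.1 hguard
    linarith
  linarith

end OnlineImproper

namespace OnlineImproper

open MeasureTheory Set Filter Topology

variable {d : ℕ} {R L μ η ε A : ℝ} {K Kstar D : Set (Vec d)} {φ : Vec d → ℝ}
  {W : PointedCone ℝ (Vec d)} {O : Vec d → Vec d}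

/-! ### Online mirror descent -/

theorem PADReturns.inner_sub_le (hO : IsImproperOracle K Kstar W O)
    (hKR : K ⊆ Metric.closedBall 0 R) (hKstarR : Kstar ⊆ Metric.closedBall 0 R) (hR : 0 < R)
    (hε : 0 < ε) (hεR : ε ≤ R) (hW : (interior (W : Set (Vec d))).Nonempty) (hP : PNIP D φ W)
    (hμ : 0 < μ) (hφ : StrongConvexOn D μ φ) {y x : Vec d} (hy : y ∈ interior D)
    {V : List (Vec d)} {p : Fin V.length → ℝ} (h : PADReturns R ε D φ W O y x V p)
    {f : Vec d} (hf : f ∈ W) (hfL : ‖f‖ ≤ L) {u : Vec d} (hu : u ∈ Kstar) :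
    ⟪f, u - x⟫ ≤ 2 * L * R + ε * L := by
  obtain ⟨c, hc, hle⟩ := h.norm_le hO hKR hR hε hεR hW hP hμ hφ hy
  obtain ⟨⟨S, hloop⟩, -, hp, -⟩ := h
  set s := ∑ i, p i • V.get i
  have hs : s ∈ Metric.closedBall (0 : Vec d) R :=
    (convex_closedBall (0 : Vec d) R).sum_mem (fun i _ => hp.1 i) hp.2
      fun i _ => hKR (hloop.mem_of_mem hO _ (List.get_mem V i))
  have h1 : u - x = (u - s) + (s + c - x) - c := by abel
  have h2 : ⟪f, u - s⟫ ≤ L * (R + R) := (real_inner_le_norm _ _).trans (by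
    gcongr
    · exact (norm_nonneg f).trans hfL
    · exact (norm_sub_le _ _).trans (add_le_add (mem_closedBall_zero_iff.1 (hKstarR hu))
        (mem_closedBall_zero_iff.1 hs)))
  have h3 : ⟪f, s + c - x⟫ ≤ L * ε := (real_inner_le_norm _ _).trans (by
    gcongr
    exact (norm_nonneg f).trans hfL)
  have h4 : 0 ≤ ⟪f, c⟫ := ProperCone.mem_innerDual.1 hc hf
  rw [h1, inner_sub_right, inner_add_right]
  linarith

theorem bregman_gradient_step_le (hμ : 0 < μ) (hη : 0 < η) (hφ : StrongConvexOn D μ φ)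
    {x y' f u : Vec d} (hx : x ∈ D) (hdx : DifferentiableAt ℝ φ x) (hy' : y' ∈ D)
    (hfL : ‖f‖ ≤ L) (hupd : ∇ φ y' = ∇ φ x - η • f) :
    bregman φ u y' ≤ bregman φ u x + η ^ 2 * L ^ 2 / (2 * μ) + η * ⟪f, u - x⟫ := by
  have h1 := bregman_three_point φ u x y'
  have h2 := half_mul_sq_le_bregman hφ hy' hx hdx
  have h3 : ∇ φ y' - ∇ φ x = (-η) • f := by rw [hupd]; module
  have h4 : u - y' = (u - x) - (y' - x) := by abel
  rw [h3, real_inner_smul_left, h4, inner_sub_right] at h1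
  set n := ‖y' - x‖
  have h5 : -(L * n) ≤ ⟪f, y' - x⟫ := by
    have h6 := (abs_le.1 (abs_real_inner_le_norm f (y' - x))).1
    have h7 : ‖f‖ * ‖y' - x‖ ≤ L * n := by gcongr
    linarith
  -- Maximizing the quadratic over `n` gives `n = η L / μ`.
  have h8 : η * (L * n) - μ / 2 * n ^ 2 ≤ η ^ 2 * L ^ 2 / (2 * μ) := by
    rw [le_div_iff₀ (by positivity)]
    nlinarith [sq_nonneg (η * L - μ * n)]
  have h9 := mul_le_mul_of_nonneg_left h5 hη.le
  linarith

theorem OMDReach.bregman_le (hO : IsImproperOracle K Kstar W O)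
    (hKR : K ⊆ Metric.closedBall 0 R) (hKstarR : Kstar ⊆ Metric.closedBall 0 R) (hR : 0 < R)
    (hε : 0 < ε) (hεR : ε ≤ R) (hW : (interior (W : Set (Vec d))).Nonempty) (hP : PNIP D φ W)
    (hμ : 0 < μ) (hη : 0 < η) (hφ : StrongConvexOn D μ φ) (hKD : Kstar ⊆ D)
    (hD : (interior D).Nonempty) {y₁ : Vec d}
    (hy₁_min : IsMinOn φ D y₁) (hA : ∀ x ∈ Kstar, φ x - φ y₁ ≤ A) {t : ℕ} {y : Vec d}
    (h : OMDReach R ε η L D φ W O t y) :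
    y ∈ interior D ∧ 1 ≤ t ∧ ∀ u ∈ Kstar, bregman φ u y ≤
      A + (η ^ 2 * L ^ 2 / (2 * μ) + 2 * η * L * R + ε * η * L) * ((t : ℝ) - 1) := by
  have hφ₀ : StrongConvexOn D 0 φ := hφ.mono hμ.le
  induction h with
  | @start y mem isMin =>
    have hy := hP.legendre.mem_interior_of_isMinOn hφ₀ hD mem isMin
    refine ⟨hy, le_rfl, fun u hu => ?_⟩
    have h1 := hA u hu
    -- An execution may start at any minimizer, not a priori at `y₁`.
    have h2 : φ y₁ ≤ φ y := hy₁_min mem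
    simp only [bregman, gradient_eq_zero_of_isMinOn hy isMin, inner_zero_left, Nat.cast_one,
      sub_self, mul_zero]
    linarith
  | @round t y x y' f V p prev pad loss_mem loss_le mem update ih =>
    obtain ⟨hy, ht, ih⟩ := ih
    obtain ⟨⟨S, hloop⟩, -⟩ := id pad
    have hx := hloop.mem_interior hy
    refine ⟨mem, by omega, fun u hu => ?_⟩
    have h1 := ih u hu
    have h2 := hloop.bregman_le hO hP.legendre hμ.le hφ hy hu (hKD hu)
    have h3 := bregman_gradient_step_le (u := u) hμ hη hφ (interior_subset hx)
      (hP.legendre.differentiable x hx) (interior_subset mem) loss_le update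
    have h4 := mul_le_mul_of_nonneg_left (pad.inner_sub_le hO hKR hKstarR hR hε hεR hW hP hμ hφ hy
      loss_mem loss_le hu) hη.le
    push_cast
    linarith

theorem callsPerRoundLE (hO : IsImproperOracle K Kstar W O)
    (hKR : K ⊆ Metric.closedBall 0 R) (hKstarR : Kstar ⊆ Metric.closedBall 0 R)
    (hKstar : Kstar.Nonempty) (hR : 0 < R) (hL : 0 < L)
    (hε : 0 < ε) (hεR : ε ≤ R) (hW : (interior (W : Set (Vec d))).Nonempty) (hP : PNIP D φ W)
    (hμ : 0 < μ) (hη : 0 < η) (hφ : StrongConvexOn D μ φ) (hKD : Kstar ⊆ D) {y₁ : Vec d}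
    (hy₁_min : IsMinOn φ D y₁) (hA : ∀ x ∈ Kstar, φ x - φ y₁ ≤ A) (T : ℕ) :
    CallsPerRoundLE R ε η L D φ W O T
      ⌈5 * d * Real.log ((4 * R + 2 * √(2 / μ *
        (A + (η ^ 2 * L ^ 2 / (2 * μ) + 2 * η * L * R + ε * η * L) * T))) / ε)⌉₊ := by
  intro t ht y hreach z S V hloop
  cases hloop with
  | start => simp
  | step prev guard centroid proj =>
    rename_i z w S V
    -- The interior of `D` is nonempty because the projected point lies in it.
    obtain ⟨hy, -, hbound⟩ := hreach.bregman_le hO hKR hKstarR hR hε hεR hW hP hμ hη hφ hKD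
      ⟨_, proj.1⟩ hy₁_min hA
    obtain ⟨u, hu⟩ := hKstar
    have hz := prev.mem_interior hy
    have h1 := half_mul_sq_le_bregman hφ (hKD hu) (interior_subset hz)
      (hP.legendre.differentiable z hz)
    have h2 := prev.bregman_le hO hP.legendre hμ.le hφ hy hu (hKD hu)
    have h3 := hbound u hu
    set B := η ^ 2 * L ^ 2 / (2 * μ) + 2 * η * L * R + ε * η * L
    have hB : 0 ≤ B := by positivity
    have htT : (t : ℝ) - 1 ≤ T := by
      have : (t : ℝ) ≤ T := by exact_mod_cast ht
      linarith
    have h4 : μ / 2 * ‖u - z‖ ^ 2 ≤ A + B * T :=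
      (h1.trans (h2.trans h3)).trans (by gcongr)
    have h5 : ‖u - z‖ ≤ √(2 / μ * (A + B * T)) := by
      refine Real.le_sqrt_of_sq_le ?_
      calc ‖u - z‖ ^ 2 = 2 / μ * (μ / 2 * ‖u - z‖ ^ 2) := by field_simp
        _ ≤ _ := by gcongr
    have h6 : ‖z‖ ≤ R + √(2 / μ * (A + B * T)) := by
      have h7 : ‖z‖ ≤ ‖u‖ + ‖u - z‖ := by
        have := norm_sub_le u (u - z)
        rwa [sub_sub_cancel] at this
      linarith [mem_closedBall_zero_iff.1 (hKstarR hu)]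
    -- The guard held strictly before the last call, so that call still fits under the ceiling.
    rw [List.length_append, List.length_singleton, Nat.succ_le_iff, Nat.lt_ceil]
    refine lt_of_lt_of_le guard ?_
    gcongr
    linarith

/-! ### The special parameters -/

theorem sqrt_bound_of_parameters (hR : 0 < R) (hL : 0 < L) (hμ : 0 < μ) (hA : 0 ≤ A) {T : ℝ}
    (hT : 1 ≤ T) (hε : ε = R / T) (hη : η = 1 / L * √(2 * μ * A / T)) :
    (4 * R + 2 * √(2 / μ *
        (A + (η ^ 2 * L ^ 2 / (2 * μ) + 2 * η * L * R + ε * η * L) * T))) / ε ≤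
      (6 * √T + 4 / R * √(A / μ) + 4) * T := by
  have hT₀ : 0 < T := by linarith
  set a := √(A / μ)
  set q := √T
  have ha : 0 ≤ a := Real.sqrt_nonneg _
  have hq1 : 1 ≤ q := by rw [← Real.sqrt_one]; exact Real.sqrt_le_sqrt hT
  have hq : 0 < q := by linarith
  have hAa : A = μ * a ^ 2 := by
    rw [Real.sq_sqrt (by positivity)]; field_simp
  have hTq : T = q ^ 2 := (Real.sq_sqrt hT₀.le).symm
  set s := √2
  have hs2 : s ^ 2 = 2 := Real.sq_sqrt (by norm_num)
  have hs0 : 0 ≤ s := Real.sqrt_nonneg _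
  have hs : s ≤ 3 / 2 := Real.sqrt_le_iff.2 ⟨by norm_num, by norm_num⟩
  have hηL : η * L = s * μ * a / q := by
    have h1 : √(2 * μ * A / T) = s * μ * a / q := by
      rw [Real.sqrt_eq_iff_mul_self_eq (by positivity) (by positivity), hAa, hTq]
      field_simp
      linear_combination (-a ^ 2) * hs2
    rw [hη, h1]; field_simp
  have hinner : 2 / μ * (A + (η ^ 2 * L ^ 2 / (2 * μ) + 2 * η * L * R + ε * η * L) * T) =
      4 * a ^ 2 + 4 * s * R * a * q + 2 * s * R * a / q := by
    have h2 : η ^ 2 * L ^ 2 / (2 * μ) + 2 * η * L * R + ε * η * L =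
        (η * L) ^ 2 / (2 * μ) + 2 * (η * L) * R + ε * (η * L) := by ring
    rw [h2, hηL, hε, hAa, hTq]
    field_simp
    linear_combination a ^ 2 * q * hs2
  -- The square of the right side has cross term `12 R a q`; the left side has at most `6 s R a q ≤
  -- 9 R a q`.
  have hsq : √(4 * a ^ 2 + 4 * s * R * a * q + 2 * s * R * a / q) ≤ 3 * R * q + 2 * a := by
    refine Real.sqrt_le_iff.2 ⟨by positivity, ?_⟩
    have h3 : 2 * s * R * a / q ≤ 2 * s * R * a * q := by
      rw [div_le_iff₀ hq]
      have h4 : 1 ≤ q * q := by nlinarith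
      have h5 : 0 ≤ 2 * s * R * a := by positivity
      nlinarith
    have h6 : s * (R * a * q) ≤ 3 / 2 * (R * a * q) := by gcongr
    have h7 : 0 ≤ R * a * q := by positivity
    nlinarith [sq_nonneg (R * q)]
  rw [hinner, hε, div_div_eq_mul_div]
  rw [div_le_iff₀ hR]
  calc (4 * R + 2 * √(4 * a ^ 2 + 4 * s * R * a * q + 2 * s * R * a / q)) * T
      ≤ (4 * R + 2 * (3 * R * q + 2 * a)) * T := by gcongr
    _ = _ := by field_simp; ring

theorem exists_ceil_log_le (hR : 0 < R) {a : ℝ} (ha : 0 ≤ a) :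
    ∃ C : ℝ, ∀ d' T' : ℕ, 2 ≤ T' →
      (⌈5 * d' * Real.log ((6 * √T' + 4 / R * a + 4) * T')⌉₊ : ℝ) ≤ C * (d' * Real.log T') := by
  set b : ℝ := 10 + 4 / R * a
  have hb : 1 ≤ b := by
    have : 0 ≤ 4 / R * a := by positivity
    simp only [b]; linarith
  have hl2 : 0 < Real.log 2 := Real.log_pos (by norm_num)
  refine ⟨5 * (Real.log b / Real.log 2 + 2) + 1 / Real.log 2, fun d' T' hT' => ?_⟩
  have hT : (2 : ℝ) ≤ T' := by exact_mod_cast hT'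
  have hlT : Real.log 2 ≤ Real.log T' := Real.log_le_log (by norm_num) hT
  rcases Nat.eq_zero_or_pos d' with rfl | hd
  · simp
  have hd1 : (1 : ℝ) ≤ d' := by exact_mod_cast hd
  have hsq : √(T' : ℝ) ≤ T' := by
    rw [Real.sqrt_le_left (by linarith)]; nlinarith
  have hB1 : 1 ≤ (6 * √T' + 4 / R * a + 4) * T' := by
    have h1 : 0 ≤ 6 * √(T' : ℝ) + 4 / R * a := by positivity
    nlinarith
  have hB2 : (6 * √T' + 4 / R * a + 4) * T' ≤ b * (T' : ℝ) ^ 2 := by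
    have h2 : 0 ≤ 4 / R * a := by positivity
    have h3 : 6 * √T' + 4 / R * a + 4 ≤ b * T' := by simp only [b]; nlinarith
    calc _ ≤ b * T' * T' := by gcongr
      _ = _ := by ring
  have hlog : Real.log ((6 * √T' + 4 / R * a + 4) * T') ≤
      (Real.log b / Real.log 2 + 2) * Real.log T' := by
    refine (Real.log_le_log (by linarith) hB2).trans ?_
    rw [Real.log_mul (by positivity) (by positivity), Real.log_pow, add_mul]
    push_cast
    gcongr ?_ + ?_
    · rw [div_mul_eq_mul_div, le_div_iff₀ hl2]
      have := Real.log_nonneg hb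
      gcongr
    · exact le_rfl
  -- Absorbs the `1` lost to rounding up, which is where `T' ≥ 2` and `d' ≥ 1` enter.
  have hone : 1 ≤ 1 / Real.log 2 * (d' * Real.log T') := by
    rw [one_div, ← div_eq_inv_mul, le_div_iff₀ hl2]
    nlinarith
  have hceil := (Nat.ceil_lt_add_one (a := 5 * d' * Real.log ((6 * √T' + 4 / R * a + 4) * T'))
    (mul_nonneg (by positivity) (Real.log_nonneg hB1))).le
  refine hceil.trans ?_
  calc 5 * d' * Real.log ((6 * √T' + 4 / R * a + 4) * T') + 1
      ≤ 5 * d' * ((Real.log b / Real.log 2 + 2) * Real.log T') +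
        1 / Real.log 2 * (d' * Real.log T') := by gcongr
    _ = _ := by ring

end OnlineImproper

/-! ### Assembly of the theorem. -/

theorem mainTheorem4 {d : ℕ} (R L μ η ε A : ℝ) (T : ℕ)
    (hR : 0 < R) (hL : 0 < L) (hμ : 0 < μ) (hη : 0 < η) (hε : 0 < ε) (hεR : ε ≤ R) (hT : 0 < T)
    (K Kstar : Set (OnlineImproper.Vec d))
    (hK : IsCompact K) (hKR : K ⊆ Metric.closedBall 0 R)
    (hKstar : IsCompact Kstar) (hKstarR : Kstar ⊆ Metric.closedBall 0 R)
    (hKstar_ne : Kstar.Nonempty)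
    (W : PointedCone ℝ (OnlineImproper.Vec d))
    (hW : (interior (W : Set (OnlineImproper.Vec d))).Nonempty)
    (O : OnlineImproper.Vec d → OnlineImproper.Vec d)
    (hO : OnlineImproper.IsImproperOracle K Kstar W O)
    (D : Set (OnlineImproper.Vec d)) (φ : OnlineImproper.Vec d → ℝ)
    (hKD : Kstar ⊆ D)
    (hPNIP : OnlineImproper.PNIP D φ W)
    (hφ : StrongConvexOn D μ φ)
    (y₁ : OnlineImproper.Vec d) (hy₁ : y₁ ∈ D) (hy₁_min : IsMinOn φ D y₁)
    (hA : ∀ x ∈ Kstar, φ x - φ y₁ ≤ A) :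
    OnlineImproper.CallsPerRoundLE R ε η L D φ W O T
      ⌈5 * d * Real.log ((4 * R + 2 * √(2 / μ *
        (A + (η ^ 2 * L ^ 2 / (2 * μ) + 2 * η * L * R + ε * η * L) * T))) / ε)⌉₊ ∧
    (ε = R / T → η = 1 / L * √(2 * μ * A / T) →
      OnlineImproper.CallsPerRoundLE R ε η L D φ W O T
        ⌈5 * d * Real.log ((6 * √T + 4 / R * √(A / μ) + 4) * T)⌉₊) ∧
    (∃ C : ℝ, ∀ d' T' : ℕ, 2 ≤ T' →
      (⌈5 * d' * Real.log ((6 * √T' + 4 / R * √(A / μ) + 4) * T')⌉₊ : ℝ) ≤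
        C * (d' * Real.log T')) := by 
  have hbound := OnlineImproper.callsPerRoundLE hO hKR hKstarR hKstar_ne hR hL hε hεR hW hPNIP hμ hη
    hφ hKD hy₁_min hA T
  refine ⟨hbound, fun hεT hηT => ?_, OnlineImproper.exists_ceil_log_le hR (Real.sqrt_nonneg _)⟩
  obtain ⟨x, hx⟩ := hKstar_ne
  -- Nonemptiness of `Kstar` forces `A ≥ 0`, so the square roots in the special parameters are
  -- genuine.
  have hA₀ : 0 ≤ A := (sub_nonneg.2 (hy₁_min (hKD hx))).trans (hA x hx)
  have hT₁ : (1 : ℝ) ≤ T := by exact_mod_cast hT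
  have hle := OnlineImproper.sqrt_bound_of_parameters hR hL hμ hA₀ hT₁ hεT hηT
  intro t ht y hy z S V hV
  refine (hbound t ht y hy z S V hV).trans (Nat.ceil_le_ceil ?_)
  gcongr
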